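/- Let $l_1,l_2\ge 1$ be integers and, for $j=1,2$, let $\Gamma^{(j)}(x)=\sum_r\Gamma^{(j)}_r x^r$ be a finitely supported probability distribution on degrees $r\ge 0$ (real weights) with $\Gamma^{(j)}_r>0$ for some $r\ge 2$. Write $\Gamma^{(j)\prime}(1)=\sum_r r\Gamma^{(j)}_r$ and $R_{\rm des}=1-l_1/\Gamma^{(1)\prime}(1)-l_2/\Gamma^{(2)\prime}(1)$. **Ensemble.** A graph of block length $n$ in the left-regular two edge type LDPC ensemble $\{l_1,l_2,\Gamma^{(1)},\Gamma^{(2)}\}$ has $n$ variable nodes, each with $l_1$ edges of type one and $l_2$ edges of type two, and $M^{(j)}_r$ check nodes of type $j$ and degree $r$, where $\sum_r rM^{(j)}_r=nl_j$. For each type $j$ it is given by a bijection between the $nl_j$ variable-node sockets of type $j$ and the $nl_j$ check-node sockets of type $j$ (so multiple edges are allowed), and it is chosen uniformly among all such pairs of bijections. We consider any sequence of block lengths $n\to\infty$ and of counts $M^{(j)}_r=M^{(j)}_r(n)$ with $M^{(j)}_r/n\to l_j\Gamma^{(j)}_r/\Gamma^{(j)\prime}(1)$ for all $r$, and $M^{(j)}_r=0$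 if $\Gamma^{(j)}_r=0$; in particular $M^{(j)}_r=nl_j\Gamma^{(j)}_r/\Gamma^{(j)\prime}(1)$, along those $n$ for which these are integers. The code of a graph $G$ is the set of $x\in\mathbb F_2^n$ with $H_1x=0$ and $H_2x=0$, where the entries of $H_j$ are the numbers of type $j$ edges between check and variable nodes, modulo 2. Let $N$ be its number of codewords and $R_G=\frac1n\log_2N$ its rate. **The function $\theta$.** Let $h(e)=-e\log_2e-(1-e)\log_2(1-e)$, $q_r(v)=\frac{(1+v)^r+(1-v)^r}{2}$ and $$\epsilon_j=1-\frac{\sum_{r\text{ odd}}\Gamma^{(j)}_r}{\Gamma^{(j)\prime}(1)}\in(0,1].$$ For $0<e<\epsilon_j$ the equation $$\frac{v_j}{\Gamma^{(j)\prime}(1)}\sum_r r\,\Gamma^{(j)}_r\,\frac{(1+v_j)^{r-1}-(1-v_j)^{r-1}}{(1+v_j)^{r}+(1-v_j)^{r}}=e$$ has a unique positive solution $v_j=v_j(e)$, and the set $D$ of those $e\in(0,1)$ for which both equations ($j=1,2$) have a positive solution is the interval $(0,\min(\epsilon_1,\epsilon_2))$. (So $D=(0,1)$ when all check degrees are even.)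 For $e\in D$ define $$\theta(e)=(1-l_1-l_2)h(e)+\sum_{j=1}^{2}\frac{l_j}{\Gamma^{(j)\prime}(1)}\sum_r\Gamma^{(j)}_r\log_2q_r(v_j(e))-e\,l_1\log_2v_1(e)-e\,l_2\log_2v_2(e)-R_{\rm des}.$$ **Lemma.** The function $\theta$ is bounded above on $D\ne\emptyset$, and $$\lim_{n\to\infty}\frac{\log_2\mathbb E[N]}{n}=\sup_{e\in D}\theta(e)+R_{\rm des}.$$ If $\sup_{e\in D}\theta(e)=0$, then $\lim_{n\to\infty}\mathbb P(R_G>R_{\rm des}+\delta)=0$ for every $\delta>0$. If moreover $\Gamma^{(j)}_0=\Gamma^{(j)}_1=0$ for $j=1,2$ (all check degrees are at least 2), then $1/2\in D$, and the condition $\sup_{D}\theta=0$ is equivalent to $\theta(1/2)\ge\theta(e)$ for all $e\in D$. -/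

import Mathlib

open Filter Topology Set
open scoped Polynomial

namespace TwoEdgeLDPC

noncomputable section

/-! ### Graphs, codes and the uniform ensemble

`M : ℕ →₀ ℕ` records a collection of check nodes: `M r` is the number of check nodes of degree
`r`. -/

/-- The check nodes (of one type). -/
abbrev CheckNode (M : ℕ →₀ ℕ) : Type := Σ r : M.support, Fin (M r)

/-- The check node sockets (of one type): a check node of degree `r` has `r` sockets. -/
abbrev CheckSocket (M : ℕ →₀ ℕ) : Type := Σ c : CheckNode M, Fin (c.1 : ℕ)

/-- The variable node sockets of one type: each of the `n` variable nodes has `l` of them. -/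
abbrev VarSocket (n l : ℕ) : Type := Fin n × Fin l

/-- A left-regular two edge type bipartite multigraph with `n` variable nodes, each with `l₁`
edges of type one and `l₂` edges of type two, and with `M₁ r` (resp. `M₂ r`) check nodes of degree
`r` and type one (resp. two): for each type, a matching of the variable node sockets with the check
node sockets. Multiple edges between two nodes are allowed. -/
abbrev TannerGraph (n l₁ l₂ : ℕ) (M₁ M₂ : ℕ →₀ ℕ) : Type :=
  (VarSocket n l₁ ≃ CheckSocket M₁) × (VarSocket n l₂ ≃ CheckSocket M₂)

/-- The parity-check matrix over `𝔽₂` of the edges of one type: the entry at `(c, i)` is the number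
of edges between check node `c` and variable node `i`, modulo 2. -/
def parityMatrix {n l : ℕ} {M : ℕ →₀ ℕ} (σ : VarSocket n l ≃ CheckSocket M) :
    Matrix (CheckNode M) (Fin n) (ZMod 2) :=
  Matrix.of fun c i => ((Finset.univ.filter fun s : Fin l => (σ (i, s)).1 = c).card : ZMod 2)

variable {n l₁ l₂ : ℕ} {M₁ M₂ : ℕ →₀ ℕ}

/-- The code of a graph: the words `x` with `H₁ x = 0` and `H₂ x = 0`. -/
def codewords (G : TannerGraph n l₁ l₂ M₁ M₂) : Set (Fin n → ZMod 2) :=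
  {x | (parityMatrix G.1).mulVec x = 0 ∧ (parityMatrix G.2).mulVec x = 0}

/-- The number `N` of codewords. -/
def numCodewords (G : TannerGraph n l₁ l₂ M₁ M₂) : ℕ := (codewords G).ncard

/-- The actual rate `R_G = log₂ N / n`. -/
def rate (G : TannerGraph n l₁ l₂ M₁ M₂) : ℝ := Real.logb 2 (numCodewords G) / n

/-- `𝔼[N]`, for a uniformly random graph. -/
def expNumCodewords (n l₁ l₂ : ℕ) (M₁ M₂ : ℕ →₀ ℕ) : ℝ :=
  (∑ G : TannerGraph n l₁ l₂ M₁ M₂, (numCodewords G : ℝ)) /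
    Fintype.card (TannerGraph n l₁ l₂ M₁ M₂)

/-- `ℙ(R_G > t)`, for a uniformly random graph. -/
def probRateGT (n l₁ l₂ : ℕ) (M₁ M₂ : ℕ →₀ ℕ) (t : ℝ) : ℝ :=
  ({G : TannerGraph n l₁ l₂ M₁ M₂ | t < rate G}.ncard : ℝ) /
    Fintype.card (TannerGraph n l₁ l₂ M₁ M₂)

/-! ### Degree distributions -/

/-- `Γ(x) = ∑ r, Γ_r x ^ r` is a degree distribution from the node perspective. -/
structure IsDegreeDist (Γ : ℝ[X]) : Prop where
  nonneg : ∀ r, 0 ≤ Γ.coeff r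
  sum_eq_one : Γ.eval 1 = 1

/-- The average degree `Γ'(1)`. -/
def avgDegree (Γ : ℝ[X]) : ℝ := Γ.derivative.eval 1

/-- The check node counts `M k` (one edge type) of a sequence of left-regular graphs with `n k`
variable nodes of degree `l` follow the degree distribution `Γ`: the numbers of edges on both sides
agree, only degrees occurring in `Γ` occur, and the number of check nodes of degree `r`, divided by
`n k`, tends to `Γ_r l / Γ'(1)`. In particular this allows the counts to be equal to
`n k * (Γ_r l / Γ'(1))` for all `k`, if these numbers are integers. -/
structure FollowsDegreeDist (l : ℕ) (Γ : ℝ[X]) (n : ℕ → ℕ) (M : ℕ → ℕ →₀ ℕ) : Prop where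
  edges : ∀ k, ((M k).sum fun r m => r * m) = n k * l
  support : ∀ k, (M k).support ⊆ Γ.support
  tendsto : ∀ r, Tendsto (fun k => (M k r : ℝ) / n k) atTop (𝓝 (Γ.coeff r * l / avgDegree Γ))

/-- The design rate `1 - (m₁ + m₂) / n`, where `m_j = n l_j / Γ_j'(1)`. -/
def designRate (l₁ l₂ : ℕ) (Γ₁ Γ₂ : ℝ[X]) : ℝ :=
  1 - l₁ / avgDegree Γ₁ - l₂ / avgDegree Γ₂

/-! ### The function `θ` -/

/-- Binary entropy in bits. -/
def binEntropy₂ (x : ℝ) : ℝ := -x * Real.logb 2 x - (1 - x) * Real.logb 2 (1 - x)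

/-- `q_r(v) = ((1 + v) ^ r + (1 - v) ^ r) / 2`. -/
def q (r : ℕ) (v : ℝ) : ℝ := ((1 + v) ^ r + (1 - v) ^ r) / 2

/-- The left-hand side of the saddle point equation `saddle Γ v = e`. The summand with `r = 0`
vanishes because of the factor `r`. -/
def saddle (Γ : ℝ[X]) (v : ℝ) : ℝ :=
  v / avgDegree Γ * Γ.sum fun r g =>
    r * g * (((1 + v) ^ (r - 1) - (1 - v) ^ (r - 1)) / ((1 + v) ^ r + (1 - v) ^ r))

open Classical in
/-- The positive solution `v` of `saddle Γ v = e` (and `0` if there is none). -/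
def saddleRoot (Γ : ℝ[X]) (e : ℝ) : ℝ :=
  if h : ∃ v : ℝ, 0 < v ∧ saddle Γ v = e then h.choose else 0

/-- The set of those `e ∈ (0, 1)` for which both saddle point equations have a positive solution,
i.e. for which `θ(e)` is defined. -/
def thetaDomain (Γ₁ Γ₂ : ℝ[X]) : Set ℝ :=
  {e | e ∈ Ioo (0 : ℝ) 1 ∧ (∃ v : ℝ, 0 < v ∧ saddle Γ₁ v = e) ∧ ∃ v : ℝ, 0 < v ∧ saddle Γ₂ v = e}

/-- The function `θ`, on `thetaDomain Γ₁ Γ₂`. -/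
def theta (l₁ l₂ : ℕ) (Γ₁ Γ₂ : ℝ[X]) (e : ℝ) : ℝ :=
  (1 - l₁ - l₂) * binEntropy₂ e
    + l₁ / avgDegree Γ₁ * Γ₁.sum (fun r g => g * Real.logb 2 (q r (saddleRoot Γ₁ e)))
    + l₂ / avgDegree Γ₂ * Γ₂.sum (fun r g => g * Real.logb 2 (q r (saddleRoot Γ₂ e)))
    - e * l₁ * Real.logb 2 (saddleRoot Γ₁ e) - e * l₂ * Real.logb 2 (saddleRoot Γ₂ e)
    - designRate l₁ l₂ Γ₁ Γ₂

/-- `1 - (∑_{r odd} Γ_r) / Γ'(1)`: asymptotically, the largest fraction of edges that can carry the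
value one when every check node sees an even number of ones. -/
def maxFraction (Γ : ℝ[X]) : ℝ :=
  1 - (Γ.sum fun r g => if Odd r then g else 0) / avgDegree Γ

end

end TwoEdgeLDPC

open TwoEdgeLDPC

namespace TwoEdgeLDPC

/-! ### Counting graphs and codewords -/

section Counting

variable {α β : Type*} [Fintype α] [Fintype β] [DecidableEq α] [DecidableEq β]

/-! Write A_j(s) (`evenCount`) for the number of s-element sets of type j check sockets meeting
every check node evenly. A uniform bijection sends the sockets of a word of weight w to a uniform
set of w l_j sockets, so E[N] = Σ_w C(n,w) ∏_j A_j(w l_j) / C(n l_j, w l_j). There are n + 1 terms,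
so the growth rate is that of the largest one. The A_j(s) are the coefficients of ∏_r q_r(v)^{M_r}.

Upper bound: A_j(s) ≤ v^{-s} ∏_r q_r(v)^{M_r} for every v > 0, and entropy bounds the binomials. The
saddle point is the best v, but any pair v₁, v₂ is allowed. This freedom treats limiting relative
weights e at the ends of D (approach from inside) and beyond them (v → ∞); compactness of [0,1] then
makes the bound uniform in w (`exists_exponent_le`, `eventually_forall_weightTerm_le`).

Lower bound, without a local limit theorem: at a given v the largest term of the generating function
equals it up to a polynomial factor. Differentiability of the limiting logarithm forces its size to
be asymptotic to n l saddle(v) (`FollowsDegreeDist.tendsto_argmax`). Away from the extreme sizes,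
ratios of consecutive even counts are bounded (`evenCount_ratio`), so moving by o(n) to the
prescribed size costs only a factor e^{o(n)}.

Concentration of the rate is Markov's inequality. Without degrees 0 and 1, v = 1 solves both saddle
equations at e = 1/2 and θ(1/2) = 0, so the supremum vanishes exactly when 1/2 is a maximiser. -/

theorem exists_perm_map_eq {T T' : Finset β} (h : T.card = T'.card) :
    ∃ π : Equiv.Perm β, T.map π.toEmbedding = T' := by
  have e : {x // x ∈ T} ≃ {x // x ∈ T'} := Fintype.equivOfCardEq (by simpa using h)
  refine ⟨e.extendSubtype, Finset.eq_of_subset_of_card_le ?_ (by simp [h])⟩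
  intro y hy
  obtain ⟨x, hx, rfl⟩ := Finset.mem_map.1 hy
  exact e.extendSubtype_mem x hx

/-- Composition with a permutation carrying T to T' is a bijection between the two sets of
equivalences. -/
theorem card_equiv_map_eq_congr (X : Finset α) {T T' : Finset β} (h : T.card = T'.card) :
    (Finset.univ.filter fun σ : α ≃ β => X.map σ.toEmbedding = T).card =
      (Finset.univ.filter fun σ : α ≃ β => X.map σ.toEmbedding = T').card := by
  obtain ⟨π, rfl⟩ := exists_perm_map_eq h
  refine Finset.card_bij (fun σ _ => σ.trans π) ?_ ?_ ?_
  · intro σ hσ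
    simp only [Finset.mem_filter, Finset.mem_univ, true_and] at hσ ⊢
    rw [← hσ, Finset.map_map]
    rfl
  · intro σ _ τ _ hστ
    ext x
    have := congrArg (fun f => f x) hστ
    simpa using this
  · intro σ hσ
    refine ⟨σ.trans π.symm, ?_, by ext; simp⟩
    simp only [Finset.mem_filter, Finset.mem_univ, true_and] at hσ ⊢
    have : X.map (σ.trans π.symm).toEmbedding =
        (X.map σ.toEmbedding).map π.symm.toEmbedding := by
      rw [Finset.map_map]; rfl
    rw [this, hσ, Finset.map_map]
    ext; simp

/-- A uniformly random bijection maps a fixed finset to a uniformly random finset of the same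
cardinality. -/
theorem card_equiv_filter_mul_choose (hαβ : Fintype.card α = Fintype.card β) (X : Finset α)
    (p : Finset β → Prop) [DecidablePred p] :
    (Finset.univ.filter fun σ : α ≃ β => p (X.map σ.toEmbedding)).card *
        (Fintype.card α).choose X.card =
      (Finset.univ.filter fun T : Finset β => T.card = X.card ∧ p T).card *
        Fintype.card (α ≃ β) := by
  obtain ⟨σ₀⟩ : Nonempty (α ≃ β) := Fintype.card_eq.1 hαβ
  set K := (Finset.univ.filter fun σ : α ≃ β =>
    X.map σ.toEmbedding = X.map σ₀.toEmbedding).card with hK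
  -- All nonempty fibres of σ ↦ σ(X) have the same size K. The instance p = True below expresses K
  -- through the binomial coefficient, which eliminates it.
  have key : ∀ (p : Finset β → Prop) [DecidablePred p],
      (Finset.univ.filter fun σ : α ≃ β => p (X.map σ.toEmbedding)).card =
      (Finset.univ.filter fun T : Finset β => T.card = X.card ∧ p T).card * K := by
    intro p _
    rw [Finset.card_eq_sum_card_fiberwise (f := fun σ : α ≃ β => X.map σ.toEmbedding)
      (t := Finset.univ.filter fun T : Finset β => T.card = X.card ∧ p T)]
    · rw [Finset.sum_const_nat]
      intro T hT
      simp only [Finset.mem_filter, Finset.mem_univ, true_and] at hT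
      rw [hK, ← card_equiv_map_eq_congr X (T := T) (by simp [hT.1])]
      congr 1
      ext σ
      simp only [Finset.mem_filter, Finset.mem_univ, true_and, and_iff_right_iff_imp]
      rintro rfl
      exact hT.2
    · intro σ hσ
      simpa using hσ
  have htot := key (fun _ => True)
  have hc : (Finset.univ.filter fun T : Finset β => T.card = X.card ∧ True).card =
      (Fintype.card α).choose X.card := by
    rw [hαβ, ← Finset.card_univ, ← Finset.card_powersetCard]
    congr 1
    ext T
    simp [Finset.mem_powersetCard]
  rw [hc] at htot
  simp only [Finset.filter_true, Finset.card_univ] at htot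
  rw [key p, htot]
  ring

end Counting

/-! ### Even socket sets and the first moment -/

/-- A set of check node sockets is even if it contains an even number of sockets of every check
node. -/
def IsEvenSet {M : ℕ →₀ ℕ} (T : Finset (CheckSocket M)) : Prop :=
  ∀ c, Even (T.filter fun y => y.1 = c).card

instance {M : ℕ →₀ ℕ} : DecidablePred (IsEvenSet (M := M)) := fun _ =>
  inferInstanceAs (Decidable (∀ _, _))

/-- The number of even sets of `s` check node sockets. -/
def evenCount (M : ℕ →₀ ℕ) (s : ℕ) : ℕ :=
  (Finset.univ.filter fun T : Finset (CheckSocket M) => T.card = s ∧ IsEvenSet T).card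

theorem prod_checkNode {R : Type*} [CommMonoid R] (M : ℕ →₀ ℕ) (f : ℕ → R) :
    ∏ c : CheckNode M, f (c.1 : ℕ) = M.prod fun r m => f r ^ m := by
  rw [Fintype.prod_sigma]
  simp only [Finset.prod_const, Finset.card_univ, Fintype.card_fin]
  exact Finset.prod_coe_sort M.support fun r => f r ^ M r

theorem sum_checkNode {R : Type*} [AddCommMonoid R] (M : ℕ →₀ ℕ) (f : ℕ → R) :
    ∑ c : CheckNode M, f (c.1 : ℕ) = M.sum fun r m => m • f r := by
  rw [Fintype.sum_sigma]
  simp only [Finset.sum_const, Finset.card_univ, Fintype.card_fin]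
  exact Finset.sum_coe_sort M.support fun r => M r • f r

theorem card_checkSocket (M : ℕ →₀ ℕ) :
    Fintype.card (CheckSocket M) = M.sum fun r m => r * m := by
  rw [Fintype.card_sigma]
  simp only [Fintype.card_fin]
  rw [sum_checkNode M fun r => r]
  simp [mul_comm]

theorem card_varSocket (n l : ℕ) : Fintype.card (VarSocket n l) = n * l := by simp

/-- The variable node sockets carrying the value one. -/
def activeSockets {n : ℕ} (l : ℕ) (S : Finset (Fin n)) : Finset (VarSocket n l) :=
  S ×ˢ Finset.univ

/-- The word with support `S`. -/
def wordOf {n : ℕ} (S : Finset (Fin n)) : Fin n → ZMod 2 := fun i => if i ∈ S then 1 else 0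

theorem wordOf_bijective {n : ℕ} : Function.Bijective (wordOf (n := n)) := by
  constructor
  · intro S T h
    ext i
    have := congrFun h i
    simp only [wordOf] at this
    split_ifs at this with h1 h2 h2 <;> simp_all
  · intro x
    refine ⟨Finset.univ.filter fun i => x i = 1, ?_⟩
    ext1 i
    have : ∀ z : ZMod 2, (if z = 1 then (1 : ZMod 2) else 0) = z := by decide
    simpa [wordOf] using this (x i)

/-- Entry c of H x counts, mod 2, the sockets of c matched to active variable sockets; multiple
edges enter both sides with their multiplicity. -/
theorem parityMatrix_mulVec_wordOf {n l : ℕ} {M : ℕ →₀ ℕ} (σ : VarSocket n l ≃ CheckSocket M)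
    (S : Finset (Fin n)) :
    (parityMatrix σ).mulVec (wordOf S) = 0 ↔
      IsEvenSet ((activeSockets l S).map σ.toEmbedding) := by
  rw [funext_iff]
  refine forall_congr' fun c => ?_
  rw [← ZMod.natCast_eq_zero_iff_even, Finset.filter_map, Finset.card_map]
  have : (Finset.filter ((fun y : CheckSocket M => y.1 = c) ∘ σ.toEmbedding)
      (activeSockets l S)).card = ∑ i ∈ S, (Finset.univ.filter fun s : Fin l =>
        (σ (i, s)).1 = c).card := by
    simp only [Finset.card_filter, activeSockets, Finset.sum_product]
    rfl
  rw [this]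
  simp [parityMatrix, Matrix.mulVec, dotProduct, wordOf, Finset.sum_ite_mem]

theorem card_graph_even {n l : ℕ} {M : ℕ →₀ ℕ} (hM : (M.sum fun r m => r * m) = n * l)
    (S : Finset (Fin n)) :
    (Finset.univ.filter fun σ : VarSocket n l ≃ CheckSocket M =>
        IsEvenSet ((activeSockets l S).map σ.toEmbedding)).card * (n * l).choose (S.card * l) =
      evenCount M (S.card * l) * Fintype.card (VarSocket n l ≃ CheckSocket M) := by
  have h : (activeSockets l S).card = S.card * l := by simp [activeSockets]
  have := card_equiv_filter_mul_choose (α := VarSocket n l) (β := CheckSocket M)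
    (by rw [card_checkSocket, hM, card_varSocket]) (activeSockets l S) IsEvenSet
  rwa [h, card_varSocket] at this

theorem card_graph_pos {n l : ℕ} {M : ℕ →₀ ℕ} (hM : (M.sum fun r m => r * m) = n * l) :
    0 < Fintype.card (VarSocket n l ≃ CheckSocket M) := by
  rw [Fintype.card_pos_iff]
  exact Fintype.card_eq.1 (by rw [card_checkSocket, hM, card_varSocket])

theorem numCodewords_eq {n l₁ l₂ : ℕ} {M₁ M₂ : ℕ →₀ ℕ} (G : TannerGraph n l₁ l₂ M₁ M₂) :
    numCodewords G = ∑ S : Finset (Fin n),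
      (if IsEvenSet ((activeSockets l₁ S).map G.1.toEmbedding) then 1 else 0) *
      (if IsEvenSet ((activeSockets l₂ S).map G.2.toEmbedding) then 1 else 0) := by
  have : codewords G = wordOf '' {S : Finset (Fin n) |
      IsEvenSet ((activeSockets l₁ S).map G.1.toEmbedding) ∧
      IsEvenSet ((activeSockets l₂ S).map G.2.toEmbedding)} := by
    ext x
    obtain ⟨S, rfl⟩ := wordOf_bijective.2 x
    simp only [codewords, mem_ofPred_eq, parityMatrix_mulVec_wordOf,
      wordOf_bijective.1.mem_set_image]
  rw [numCodewords, this, Set.ncard_image_of_injective _ wordOf_bijective.1,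
    ← Finset.coe_filter_univ, Set.ncard_coe_finset, Finset.card_filter]
  simp only [← ite_and, mul_ite, mul_one, mul_zero]
  refine Finset.sum_congr rfl fun S _ => ?_
  split_ifs <;> simp_all

theorem sum_numCodewords (n l₁ l₂ : ℕ) (M₁ M₂ : ℕ →₀ ℕ) :
    ∑ G : TannerGraph n l₁ l₂ M₁ M₂, numCodewords G = ∑ S : Finset (Fin n),
      (Finset.univ.filter fun σ : VarSocket n l₁ ≃ CheckSocket M₁ =>
        IsEvenSet ((activeSockets l₁ S).map σ.toEmbedding)).card *
      (Finset.univ.filter fun σ : VarSocket n l₂ ≃ CheckSocket M₂ =>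
        IsEvenSet ((activeSockets l₂ S).map σ.toEmbedding)).card := by
  simp only [numCodewords_eq]
  rw [Finset.sum_comm]
  refine Finset.sum_congr rfl fun S _ => ?_
  rw [Fintype.sum_prod_type, Finset.card_filter, Finset.card_filter, Finset.sum_mul_sum]

/-- The expected number of codewords of weight `w`. -/
noncomputable def weightTerm (n l₁ l₂ : ℕ) (M₁ M₂ : ℕ →₀ ℕ) (w : ℕ) : ℝ :=
  n.choose w * (evenCount M₁ (w * l₁) / (n * l₁).choose (w * l₁)) *
    (evenCount M₂ (w * l₂) / (n * l₂).choose (w * l₂))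

/-- Linearity of expectation: the two matchings are independent, and the probability that a word
satisfies the checks of one type depends only on its weight. -/
theorem expNumCodewords_eq {n l₁ l₂ : ℕ} {M₁ M₂ : ℕ →₀ ℕ}
    (h₁ : (M₁.sum fun r m => r * m) = n * l₁) (h₂ : (M₂.sum fun r m => r * m) = n * l₂) :
    expNumCodewords n l₁ l₂ M₁ M₂ =
      ∑ w ∈ Finset.range (n + 1), weightTerm n l₁ l₂ M₁ M₂ w := by
  have key : ∀ (l : ℕ) (M : ℕ →₀ ℕ), (M.sum fun r m => r * m) = n * l → ∀ S : Finset (Fin n),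
      ((Finset.univ.filter fun σ : VarSocket n l ≃ CheckSocket M =>
        IsEvenSet ((activeSockets l S).map σ.toEmbedding)).card : ℝ) =
      evenCount M (S.card * l) / (n * l).choose (S.card * l) *
        Fintype.card (VarSocket n l ≃ CheckSocket M) := by
    intro l M hM S
    have hc : 0 < (n * l).choose (S.card * l) :=
      Nat.choose_pos (Nat.mul_le_mul_right _ (by simpa using S.card_le_univ))
    have hc' : ((n * l).choose (S.card * l) : ℝ) ≠ 0 := by positivity
    have := card_graph_even hM S
    rw [div_mul_eq_mul_div, eq_div_iff hc']
    exact_mod_cast this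
  have hc : ((Fintype.card (TannerGraph n l₁ l₂ M₁ M₂) : ℕ) : ℝ) =
      Fintype.card (VarSocket n l₁ ≃ CheckSocket M₁) *
      Fintype.card (VarSocket n l₂ ≃ CheckSocket M₂) := by
    rw [Fintype.card_prod]; push_cast; rfl
  have hp₁ : (0 : ℝ) < Fintype.card (VarSocket n l₁ ≃ CheckSocket M₁) := by
    exact_mod_cast card_graph_pos h₁
  have hp₂ : (0 : ℝ) < Fintype.card (VarSocket n l₂ ≃ CheckSocket M₂) := by
    exact_mod_cast card_graph_pos h₂
  rw [expNumCodewords, hc, div_eq_iff (by positivity), ← Nat.cast_sum, sum_numCodewords,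
    Nat.cast_sum]
  simp only [Nat.cast_mul, key l₁ M₁ h₁, key l₂ M₂ h₂]
  have := Finset.sum_powerset_apply_card (x := (Finset.univ : Finset (Fin n)))
    (fun w => ((evenCount M₁ (w * l₁) : ℝ) / (n * l₁).choose (w * l₁)) *
      (evenCount M₂ (w * l₂) / (n * l₂).choose (w * l₂)))
  rw [Finset.powerset_univ, Finset.card_univ, Fintype.card_fin] at this
  simp only [weightTerm, nsmul_eq_mul, ← mul_assoc] at this ⊢
  rw [← this, Finset.sum_mul, Finset.sum_mul]
  refine Finset.sum_congr rfl fun S _ => by ring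

/-! ### Generating functions of even socket sets -/

open Polynomial in
/-- The generating function `∑ k, (r.choose (2 * k)) X ^ k` of the even subsets of an `r`-element
set, as a sum over these subsets. -/
noncomputable def evenPoly (r : ℕ) : ℝ[X] :=
  ∑ T : Finset (Fin r), if Even T.card then X ^ (T.card / 2) else 0

/-- The generating function of the even sets of check node sockets. -/
noncomputable def checkPoly (M : ℕ →₀ ℕ) : ℝ[X] := M.prod fun r m => evenPoly r ^ m

theorem coeff_evenPoly (r k : ℕ) : (evenPoly r).coeff k = r.choose (2 * k) := by
  have h : ∀ T : Finset (Fin r),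
      (if Even T.card then (Polynomial.X : ℝ[X]) ^ (T.card / 2) else 0).coeff k =
        if T.card = 2 * k then 1 else 0 := by
    intro T
    split_ifs with h1 h2 h2
    · rw [h2]; simp
    · rw [Polynomial.coeff_X_pow, if_neg]
      obtain ⟨m, hm⟩ := h1
      omega
    · exact absurd (h2 ▸ even_two_mul k) h1
    · simp
  rw [evenPoly, Polynomial.finsetSum_coeff, Finset.sum_congr rfl fun T _ => h T,
    Finset.sum_boole]
  simp

/-- Averaging the binomial expansions at v and -v cancels the odd subsets. -/
theorem eval_evenPoly (r : ℕ) (v : ℝ) : (evenPoly r).eval (v ^ 2) = q r v := by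
  have h := Fin.sum_pow_mul_eq_add_pow (n := r) v 1
  have h' := Fin.sum_pow_mul_eq_add_pow (n := r) (-v) 1
  simp only [one_pow, mul_one] at h h'
  rw [q, add_comm 1 v, show 1 - v = -v + 1 by ring, ← h, ← h', evenPoly,
    Polynomial.eval_finsetSum, ← Finset.sum_add_distrib, Finset.sum_div]
  refine Finset.sum_congr rfl fun T _ => ?_
  split_ifs with hT
  · rw [Polynomial.eval_pow, Polynomial.eval_X, ← pow_mul, Nat.mul_div_cancel' hT.two_dvd,
      hT.neg_pow]
    ring
  · rw [(Nat.not_even_iff_odd.1 hT).neg_pow]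
    simp

theorem checkPoly_eq_prod (M : ℕ →₀ ℕ) : checkPoly M = ∏ c : CheckNode M, evenPoly c.1 :=
  (prod_checkNode M evenPoly).symm

/-- A set of check node sockets is a choice of a set of sockets for every check node. -/
def socketSetEquiv (M : ℕ →₀ ℕ) :
    (∀ c : CheckNode M, Finset (Fin (c.1 : ℕ))) ≃ Finset (CheckSocket M) where
  toFun p := Finset.univ.sigma p
  invFun T c := Finset.univ.filter fun i => ⟨c, i⟩ ∈ T
  left_inv p := by ext; simp
  right_inv T := by ext ⟨c, i⟩; simp

theorem card_filter_socketSetEquiv (M : ℕ →₀ ℕ) (p : ∀ c : CheckNode M, Finset (Fin (c.1 : ℕ)))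
    (c : CheckNode M) :
    ((socketSetEquiv M p).filter fun y => y.1 = c).card = (p c).card := by
  symm
  refine Finset.card_bij (fun i _ => ⟨c, i⟩) ?_ ?_ ?_
  · intro i hi
    simpa [socketSetEquiv] using hi
  · intro i _ j _ h
    simpa using h
  · rintro ⟨c', i⟩ h
    simp only [socketSetEquiv, Equiv.coe_fn_mk, Finset.mem_filter, Finset.mem_sigma,
      Finset.mem_univ, true_and] at h
    obtain ⟨h, rfl⟩ := h
    exact ⟨i, h, rfl⟩

theorem card_socketSetEquiv (M : ℕ →₀ ℕ) (p : ∀ c : CheckNode M, Finset (Fin (c.1 : ℕ))) :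
    (socketSetEquiv M p).card = ∑ c, (p c).card := by
  simp [socketSetEquiv, Finset.card_sigma]

theorem isEvenSet_socketSetEquiv (M : ℕ →₀ ℕ) (p : ∀ c : CheckNode M, Finset (Fin (c.1 : ℕ))) :
    IsEvenSet (socketSetEquiv M p) ↔ ∀ c, Even (p c).card := by
  simp only [IsEvenSet, card_filter_socketSetEquiv]

theorem IsEvenSet.even_card {M : ℕ →₀ ℕ} {T : Finset (CheckSocket M)} (hT : IsEvenSet T) :
    Even T.card := by
  obtain ⟨p, rfl⟩ := (socketSetEquiv M).surjective T
  rw [isEvenSet_socketSetEquiv] at hT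
  rw [card_socketSetEquiv]
  exact Finset.even_sum _ fun c _ => hT c

theorem evenCount_of_odd (M : ℕ →₀ ℕ) {s : ℕ} (hs : Odd s) : evenCount M s = 0 := by
  rw [evenCount, Finset.card_eq_zero, Finset.filter_eq_empty_iff]
  rintro T - ⟨rfl, hT⟩
  exact Nat.not_even_iff_odd.2 hs hT.even_card

/-- Expanding the product over check nodes amounts to choosing an even subset of sockets at each
node. -/
theorem coeff_checkPoly (M : ℕ →₀ ℕ) (k : ℕ) :
    (checkPoly M).coeff k = evenCount M (2 * k) := by
  have h : ∀ p : ∀ c : CheckNode M, Finset (Fin (c.1 : ℕ)),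
      (∏ c, if Even (p c).card then (Polynomial.X : ℝ[X]) ^ ((p c).card / 2) else 0).coeff k =
        if (socketSetEquiv M p).card = 2 * k ∧ IsEvenSet (socketSetEquiv M p) then 1 else 0 := by
    intro p
    simp only [isEvenSet_socketSetEquiv, card_socketSetEquiv]
    by_cases hp : ∀ c, Even (p c).card
    · rw [Finset.prod_congr rfl fun c _ => if_pos (hp c), Finset.prod_pow_eq_pow_sum,
        Polynomial.coeff_X_pow]
      have : ∑ c, (p c).card = 2 * ∑ c, (p c).card / 2 := by
        rw [Finset.mul_sum]
        exact Finset.sum_congr rfl fun c _ => (Nat.mul_div_cancel' (hp c).two_dvd).symm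
      rw [this]
      simp [hp, eq_comm]
    · rw [if_neg fun h => hp h.2]
      push Not at hp
      obtain ⟨c, hc⟩ := hp
      rw [Finset.prod_eq_zero (Finset.mem_univ c) (if_neg (by simpa using hc))]
      simp
  rw [checkPoly_eq_prod]
  simp only [evenPoly]
  rw [Finset.prod_univ_sum, Polynomial.finsetSum_coeff, Fintype.piFinset_univ,
    Finset.sum_congr rfl fun p _ => h p,
    (socketSetEquiv M).sum_comp fun T => if T.card = 2 * k ∧ IsEvenSet T then (1 : ℝ) else 0,
    Finset.sum_boole, evenCount]

theorem eval_checkPoly (M : ℕ →₀ ℕ) (v : ℝ) :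
    (checkPoly M).eval (v ^ 2) = M.prod fun r m => q r v ^ m := by
  simp [checkPoly, Finsupp.prod, Polynomial.eval_prod, eval_evenPoly]

theorem coeff_checkPoly_nonneg (M : ℕ →₀ ℕ) (k : ℕ) : 0 ≤ (checkPoly M).coeff k := by
  rw [coeff_checkPoly]; positivity

theorem q_eq_sum (r : ℕ) (v : ℝ) :
    q r v = ∑ k ∈ Finset.range (r / 2 + 1), (r.choose (2 * k) : ℝ) * v ^ (2 * k) := by
  have hdeg : (evenPoly r).natDegree < r / 2 + 1 := by
    rw [Nat.lt_succ_iff, Polynomial.natDegree_le_iff_coeff_eq_zero]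
    intro k hk
    rw [coeff_evenPoly, Nat.choose_eq_zero_of_lt (by omega), Nat.cast_zero]
  rw [← eval_evenPoly, Polynomial.eval_eq_sum_range' hdeg]
  simp only [coeff_evenPoly, pow_mul]

theorem one_le_q (r : ℕ) (v : ℝ) : 1 ≤ q r v := by
  rw [q_eq_sum]
  have := Finset.single_le_sum (f := fun k => (r.choose (2 * k) : ℝ) * v ^ (2 * k))
    (fun k _ => mul_nonneg (Nat.cast_nonneg _) ((even_two_mul k).pow_nonneg v))
    (Finset.mem_range.2 (Nat.succ_pos (r / 2)))
  simpa using this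

theorem q_pos (r : ℕ) (v : ℝ) : 0 < q r v := one_pos.trans_le (one_le_q r v)

/-- The exponent is the exact degree 2⌊r/2⌋ of q_r; averaged over degrees it produces `maxFraction`
in `meanLogQ_le`. -/
theorem q_le (r : ℕ) {v : ℝ} (hv : 1 ≤ v) : q r v ≤ 2 ^ r * v ^ (2 * (r / 2)) := by
  have h1 : q r v ≤ q r 1 * v ^ (2 * (r / 2)) := by
    rw [q_eq_sum, q_eq_sum, Finset.sum_mul]
    refine Finset.sum_le_sum fun k hk => ?_
    rw [one_pow, mul_one]
    rw [Finset.mem_range] at hk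
    exact mul_le_mul_of_nonneg_left (pow_le_pow_right₀ hv (by omega)) (by positivity)
  refine h1.trans (mul_le_mul_of_nonneg_right ?_ (by positivity))
  rw [q]
  have : (1 - 1 : ℝ) ^ r ≤ 1 := by
    rw [sub_self]; exact pow_le_one₀ le_rfl zero_le_one
  have h2 : (1 : ℝ) ≤ 2 ^ r := one_le_pow₀ one_le_two
  norm_num at *
  linarith

/-- A polynomial with nonnegative coefficients dominates each of its terms at a positive point. -/
theorem evenCount_mul_pow_le (M : ℕ →₀ ℕ) (s : ℕ) {v : ℝ} (hv : 0 < v) :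
    evenCount M s * v ^ s ≤ M.prod fun r m => q r v ^ m := by
  have hpos : 0 < M.prod fun r m => q r v ^ m :=
    Finset.prod_pos fun r _ => pow_pos (q_pos r v) _
  obtain hs | hs := Nat.even_or_odd s
  · obtain ⟨k, rfl⟩ := hs.two_dvd
    rw [← coeff_checkPoly, pow_mul, ← eval_checkPoly, Polynomial.eval_eq_sum, Polynomial.sum]
    by_cases hk : k ∈ (checkPoly M).support
    · exact Finset.single_le_sum
        (f := fun k => (checkPoly M).coeff k * (v ^ 2) ^ k)
        (fun i _ => mul_nonneg (coeff_checkPoly_nonneg M i) (by positivity)) hk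
    · rw [Polynomial.notMem_support_iff.1 hk, zero_mul]
      exact Finset.sum_nonneg fun i _ => mul_nonneg (coeff_checkPoly_nonneg M i) (by positivity)
  · rw [evenCount_of_odd M hs]
    simpa using hpos.le

theorem natDegree_checkPoly_le (M : ℕ →₀ ℕ) :
    (checkPoly M).natDegree ≤ M.sum fun r m => r * m := by
  rw [Polynomial.natDegree_le_iff_coeff_eq_zero]
  intro k hk
  rw [coeff_checkPoly, Nat.cast_eq_zero, evenCount, Finset.card_eq_zero,
    Finset.filter_eq_empty_iff]
  rintro T - ⟨hT, -⟩
  have := T.card_le_univ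
  rw [card_checkSocket] at this
  omega

/-- Some term of the generating function is at least its average. -/
theorem exists_evenCount_ge (M : ℕ →₀ ℕ) (v : ℝ) :
    ∃ k, (M.prod fun r m => q r v ^ m) ≤
      ((M.sum fun r m => r * m : ℕ) + 1) * (evenCount M (2 * k) * v ^ (2 * k)) := by
  set L := M.sum fun r m => r * m with hL
  obtain ⟨k, -, hk⟩ := Finset.exists_max_image (Finset.range (L + 1))
    (fun k => (checkPoly M).coeff k * (v ^ 2) ^ k) ⟨0, by simp⟩
  refine ⟨k, ?_⟩
  rw [← eval_checkPoly, ← coeff_checkPoly, pow_mul, Polynomial.eval_eq_sum_range'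
    (Nat.lt_succ_of_le (natDegree_checkPoly_le M))]
  refine (Finset.sum_le_card_nsmul _ _ _ hk).trans_eq ?_
  simp [hL]

/-! ### Comparison of consecutive coefficients -/

/-- All coefficients are nonnegative. -/
def CoeffNonneg (p : ℝ[X]) : Prop := ∀ k, 0 ≤ p.coeff k

theorem CoeffNonneg.add {p p' : ℝ[X]} (hp : CoeffNonneg p) (hp' : CoeffNonneg p') :
    CoeffNonneg (p + p') := fun k => by
  rw [Polynomial.coeff_add]; exact add_nonneg (hp k) (hp' k)

theorem CoeffNonneg.mul {p p' : ℝ[X]} (hp : CoeffNonneg p) (hp' : CoeffNonneg p') :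
    CoeffNonneg (p * p') := fun k => by
  rw [Polynomial.coeff_mul]
  exact Finset.sum_nonneg fun x _ => mul_nonneg (hp _) (hp' _)

theorem CoeffNonneg.prod {ι : Type*} (s : Finset ι) {p : ι → ℝ[X]}
    (h : ∀ i ∈ s, CoeffNonneg (p i)) : CoeffNonneg (∏ i ∈ s, p i) := by
  refine Finset.prod_induction _ CoeffNonneg (fun _ _ => CoeffNonneg.mul) ?_ h
  intro k
  rw [Polynomial.coeff_one]
  split_ifs <;> simp

open Polynomial in
/-- The operator `p ↦ a p' + b (X p' - d p)`. It is a derivation if `d` is regarded as a degree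
which is additive under multiplication. -/
noncomputable def degreeDeriv (a b d : ℝ) (p : ℝ[X]) : ℝ[X] :=
  C a * derivative p + C b * (X * derivative p - C d * p)

theorem degreeDeriv_mul (a b d d' : ℝ) (p p' : ℝ[X]) :
    degreeDeriv a b (d + d') (p * p') =
      degreeDeriv a b d p * p' + p * degreeDeriv a b d' p' := by
  simp only [degreeDeriv, Polynomial.derivative_mul, Polynomial.C_add]
  ring

theorem coeff_degreeDeriv (a b d : ℝ) (p : ℝ[X]) (k : ℕ) :
    (degreeDeriv a b d p).coeff k =
      a * ((k + 1) * p.coeff (k + 1)) - b * ((d - k) * p.coeff k) := by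
  have : (Polynomial.X * Polynomial.derivative p).coeff k = k * p.coeff k := by
    cases k with
    | zero => simp
    | succ k => rw [Polynomial.coeff_X_mul, Polynomial.coeff_derivative]; push_cast; ring
  rw [degreeDeriv, Polynomial.coeff_add, Polynomial.coeff_C_mul, Polynomial.coeff_C_mul,
    Polynomial.coeff_sub, this, Polynomial.coeff_C_mul, Polynomial.coeff_derivative]
  ring

/-- Bounds on ratios of consecutive coefficients pass to products once they are phrased as
nonnegativity of a derivation: in the Leibniz expansion every summand has nonnegative coefficients.
-/
theorem coeffNonneg_degreeDeriv_prod {ι : Type*} (s : Finset ι) (a b : ℝ) {d : ι → ℝ}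
    {p : ι → ℝ[X]} (h0 : ∀ i ∈ s, CoeffNonneg (p i))
    (h : ∀ i ∈ s, CoeffNonneg (degreeDeriv a b (d i) (p i))) :
    CoeffNonneg (degreeDeriv a b (∑ i ∈ s, d i) (∏ i ∈ s, p i)) := by
  classical
  induction s using Finset.induction_on with
  | empty => intro k; simp [degreeDeriv]
  | insert i s hi ih =>
    rw [Finset.sum_insert hi, Finset.prod_insert hi, degreeDeriv_mul]
    have h0' : ∀ i ∈ s, CoeffNonneg (p i) := fun j hj => h0 j (Finset.mem_insert_of_mem hj)
    exact ((h i (Finset.mem_insert_self i s)).mul (CoeffNonneg.prod s h0')).add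
      ((h0 i (Finset.mem_insert_self i s)).mul
        (ih h0' fun j hj => h j (Finset.mem_insert_of_mem hj)))

theorem choose_two_step (r k : ℕ) :
    (r.choose (2 * (k + 1)) : ℝ) * (2 * (k + 1)) * (2 * k + 1) =
      r.choose (2 * k) * ((r - 2 * k : ℕ) : ℝ) * ((r - (2 * k + 1) : ℕ) : ℝ) := by
  have h1 := Nat.choose_succ_right_eq r (2 * k)
  have h2 := Nat.choose_succ_right_eq r (2 * k + 1)
  have h : r.choose (2 * (k + 1)) * (2 * (k + 1)) * (2 * k + 1) =
      r.choose (2 * k) * (r - 2 * k) * (r - (2 * k + 1)) := by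
    rw [show 2 * (k + 1) = 2 * k + 1 + 1 by ring, h2, mul_right_comm, h1]
  exact_mod_cast h

theorem coeffNonneg_evenPoly (r : ℕ) : CoeffNonneg (evenPoly r) := fun k => by
  rw [coeff_evenPoly]; positivity

/-- With a_k = C(r,2k) and d = ⌊r/2⌋, the coefficients say (d-k) a_k ≤ (R+1)(k+1) a_{k+1} and (k+1)
a_{k+1} ≤ (2R+1)(d-k) a_k. Both follow from the two-step recursion for binomials; the constants are
not sharp. -/
theorem coeffNonneg_degreeDeriv_evenPoly {r R : ℕ} (hr : r ≤ R) :
    CoeffNonneg (degreeDeriv (R + 1) 1 (r / 2 : ℕ) (evenPoly r)) ∧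
    CoeffNonneg (degreeDeriv (-1) (-(2 * R + 1)) (r / 2 : ℕ) (evenPoly r)) := by
  have key : ∀ k : ℕ, (((r / 2 : ℕ) : ℝ) - k) * r.choose (2 * k) ≤
        (R + 1) * ((k + 1) * r.choose (2 * (k + 1))) ∧
      (k + 1) * (r.choose (2 * (k + 1)) : ℝ) ≤
        (2 * R + 1) * ((((r / 2 : ℕ) : ℝ) - k) * r.choose (2 * k)) := by
    intro k
    obtain hk | rfl | hk := lt_trichotomy k (r / 2)
    · obtain ⟨m, hm⟩ := Nat.exists_eq_add_of_lt hk
      have hd : ((r / 2 : ℕ) : ℝ) = k + m + 1 := by rw [hm]; push_cast; ring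
      have hstep := choose_two_step r k
      set A : ℝ := ((r.choose (2 * k) : ℕ) : ℝ)
      set B : ℝ := ((r.choose (2 * (k + 1)) : ℕ) : ℝ)
      have hA : 0 ≤ A := Nat.cast_nonneg _
      have hB : 0 ≤ B := Nat.cast_nonneg _
      -- Here ⌊r/2⌋ = k + m + 1, so r - 2k is 2(m+1) or 2(m+1) + 1, hence at most 3(m+1).
      have hx1 : 2 * ((m : ℝ) + 1) ≤ (r - 2 * k : ℕ) := by
        exact_mod_cast (by omega : 2 * (m + 1) ≤ r - 2 * k)
      have hx2 : ((r - 2 * k : ℕ) : ℝ) ≤ 3 * ((m : ℝ) + 1) := by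
        exact_mod_cast (by omega : r - 2 * k ≤ 3 * (m + 1))
      have hy1 : (1 : ℝ) ≤ (r - (2 * k + 1) : ℕ) := by
        exact_mod_cast (by omega : 1 ≤ r - (2 * k + 1))
      have hy2 : ((r - (2 * k + 1) : ℕ) : ℝ) ≤ R := by
        exact_mod_cast (by omega : r - (2 * k + 1) ≤ R)
      have hk2 : 2 * (k : ℝ) + 1 ≤ R := by exact_mod_cast (by omega : 2 * k + 1 ≤ R)
      set x : ℝ := ((r - 2 * k : ℕ) : ℝ)
      set y : ℝ := ((r - (2 * k + 1) : ℕ) : ℝ)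
      have hk0 : (0 : ℝ) ≤ k := Nat.cast_nonneg _
      have hm0 : (0 : ℝ) ≤ m := Nat.cast_nonneg _
      rw [hd, show (k : ℝ) + m + 1 - k = m + 1 by ring]
      have hkB : 0 ≤ ((k : ℝ) + 1) * B := by positivity
      have hmA : 0 ≤ ((m : ℝ) + 1) * A := by positivity
      constructor
      · have h1 : A * (2 * (m + 1)) * 1 ≤ A * x * y := by gcongr
        have h2 : ((k : ℝ) + 1) * B * (2 * k + 1) ≤ ((k : ℝ) + 1) * B * R := by gcongr
        nlinarith
      · have h1 : A * x * y ≤ A * (3 * (m + 1)) * R := by gcongr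
        have h2 : ((k : ℝ) + 1) * B * 1 ≤ ((k : ℝ) + 1) * B * (2 * k + 1) := by
          gcongr; linarith
        have h3 : 0 ≤ ((m : ℝ) + 1) * A * R := by positivity
        nlinarith
    · rw [Nat.choose_eq_zero_of_lt (show r < 2 * (r / 2 + 1) by omega)]
      simp
    · rw [Nat.choose_eq_zero_of_lt (show r < 2 * (k + 1) by omega),
        Nat.choose_eq_zero_of_lt (show r < 2 * k by omega)]
      simp
  refine ⟨fun k => ?_, fun k => ?_⟩
  · rw [coeff_degreeDeriv, coeff_evenPoly, coeff_evenPoly]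
    linarith [(key k).1]
  · rw [coeff_degreeDeriv, coeff_evenPoly, coeff_evenPoly]
    linarith [(key k).2]

/-- Half of the largest size of an even set of check node sockets. -/
def halfMaxSize (M : ℕ →₀ ℕ) : ℕ := M.sum fun r m => m * (r / 2)

/-- The degrees ⌊r/2⌋ of the factors add up to `halfMaxSize M`. The constants depend on R only, not
on the number of check nodes. -/
theorem evenCount_ratio {M : ℕ →₀ ℕ} {R : ℕ} (hR : ∀ r ∈ M.support, r ≤ R) (k : ℕ) :
    ((halfMaxSize M : ℝ) - k) * evenCount M (2 * k) ≤
        (R + 1) * ((k + 1) * evenCount M (2 * (k + 1))) ∧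
      (k + 1) * (evenCount M (2 * (k + 1)) : ℝ) ≤
        (2 * R + 1) * (((halfMaxSize M : ℝ) - k) * evenCount M (2 * k)) := by
  have hd : (halfMaxSize M : ℝ) = ∑ c : CheckNode M, (((c.1 : ℕ) / 2 : ℕ) : ℝ) := by
    rw [sum_checkNode M fun r => ((r / 2 : ℕ) : ℝ), halfMaxSize]
    simp [Finsupp.sum]
  have h : ∀ c : CheckNode M, (c.1 : ℕ) ≤ R := fun c => hR _ c.1.2
  have h1 := coeffNonneg_degreeDeriv_prod (Finset.univ : Finset (CheckNode M)) (R + 1) 1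
    (fun c _ => coeffNonneg_evenPoly c.1)
    (fun c _ => (coeffNonneg_degreeDeriv_evenPoly (h c)).1) k
  have h2 := coeffNonneg_degreeDeriv_prod (Finset.univ : Finset (CheckNode M)) (-1)
    (-(2 * R + 1)) (fun c _ => coeffNonneg_evenPoly c.1)
    (fun c _ => (coeffNonneg_degreeDeriv_evenPoly (h c)).2) k
  rw [coeff_degreeDeriv, ← checkPoly_eq_prod, coeff_checkPoly, coeff_checkPoly, ← hd] at h1 h2
  constructor <;> linarith

/-- Moving inside an interval on which consecutive terms are comparable. -/
theorem pow_mul_le_of_ratio {a : ℕ → ℝ} {c lo hi : ℝ} (hc : 0 ≤ c)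
    (hup : ∀ k : ℕ, lo ≤ k → (k : ℝ) + 1 ≤ hi → c * a k ≤ a (k + 1))
    (hdown : ∀ k : ℕ, lo ≤ k → (k : ℝ) + 1 ≤ hi → c * a (k + 1) ≤ a k) {i j : ℕ}
    (hi1 : lo ≤ i) (hi2 : (i : ℝ) ≤ hi) (hj1 : lo ≤ j) (hj2 : (j : ℝ) ≤ hi) :
    c ^ (max i j - min i j) * a i ≤ a j := by
  have up : ∀ m i : ℕ, lo ≤ i → (i : ℝ) + m ≤ hi → c ^ m * a i ≤ a (i + m) := by
    intro m
    induction m with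
    | zero => intro i _ _; simp
    | succ m ih =>
      intro i h1 h2
      push_cast at h2
      rw [pow_succ', mul_assoc]
      refine (mul_le_mul_of_nonneg_left (ih i h1 (by linarith)) hc).trans ?_
      exact hup (i + m) (by push_cast; linarith [(Nat.cast_nonneg m : (0 : ℝ) ≤ m)])
        (by push_cast; linarith)
  have down : ∀ m i : ℕ, lo ≤ i → (i : ℝ) + m ≤ hi → c ^ m * a (i + m) ≤ a i := by
    intro m
    induction m with
    | zero => intro i _ _; simp
    | succ m ih =>
      intro i h1 h2
      push_cast at h2
      rw [pow_succ, mul_assoc]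
      refine (mul_le_mul_of_nonneg_left (hdown (i + m)
        (by push_cast; linarith [(Nat.cast_nonneg m : (0 : ℝ) ≤ m)])
        (by push_cast; linarith)) (pow_nonneg hc m)).trans ?_
      exact ih i h1 (by linarith)
  obtain hij | hij := le_total i j
  · obtain ⟨m, rfl⟩ := Nat.exists_eq_add_of_le hij
    simpa using up m i hi1 (by exact_mod_cast hj2)
  · obtain ⟨m, rfl⟩ := Nat.exists_eq_add_of_le hij
    simpa using down m j hj1 (by exact_mod_cast hi2)

/-- The counts of even sets whose sizes are away from the extreme sizes are comparable. -/
theorem evenCount_comparable {M : ℕ →₀ ℕ} {R : ℕ} (hR : ∀ r ∈ M.support, r ≤ R) {δ C n : ℝ}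
    (hδ : 0 < δ) (hC : 0 < C) (hn : 0 < n) (hM : (halfMaxSize M : ℝ) ≤ C * n) {i j : ℕ}
    (hi1 : δ * n ≤ i) (hi2 : (i : ℝ) ≤ halfMaxSize M - δ * n)
    (hj1 : δ * n ≤ j) (hj2 : (j : ℝ) ≤ halfMaxSize M - δ * n) :
    (δ / ((2 * R + 1) * C)) ^ (max i j - min i j) * evenCount M (2 * i) ≤
      evenCount M (2 * j) := by
  have hδn : 0 < δ * n := by positivity
  have hR1 : (0 : ℝ) < 2 * R + 1 := by positivity
  refine pow_mul_le_of_ratio (a := fun k => (evenCount M (2 * k) : ℝ)) (c := δ / ((2 * R + 1) * C))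
    (by positivity) ?_ ?_ hi1 hi2 hj1 hj2
  · intro k hk1 hk2
    have h := (evenCount_ratio hR k).1
    have ha : (0 : ℝ) ≤ evenCount M (2 * k) := Nat.cast_nonneg _
    have hb : (0 : ℝ) ≤ evenCount M (2 * (k + 1)) := Nat.cast_nonneg _
    have h1 : δ * n * evenCount M (2 * k) ≤
        ((halfMaxSize M : ℝ) - k) * evenCount M (2 * k) :=
      mul_le_mul_of_nonneg_right (by linarith) ha
    have h2 : ((k : ℝ) + 1) * evenCount M (2 * (k + 1)) ≤ C * n * evenCount M (2 * (k + 1)) :=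
      mul_le_mul_of_nonneg_right (by linarith) hb
    have h3 : (R + 1) * (((k : ℝ) + 1) * evenCount M (2 * (k + 1))) ≤
        (2 * R + 1) * (C * n * evenCount M (2 * (k + 1))) :=
      mul_le_mul (by linarith [(Nat.cast_nonneg R : (0 : ℝ) ≤ R)]) h2 (by positivity) hR1.le
    rw [div_mul_eq_mul_div, div_le_iff₀ (by positivity)]
    nlinarith
  · intro k hk1 hk2
    have h := (evenCount_ratio hR k).2
    have ha : (0 : ℝ) ≤ evenCount M (2 * k) := Nat.cast_nonneg _
    have hb : (0 : ℝ) ≤ evenCount M (2 * (k + 1)) := Nat.cast_nonneg _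
    have h1 : δ * n * evenCount M (2 * (k + 1)) ≤ ((k : ℝ) + 1) * evenCount M (2 * (k + 1)) :=
      mul_le_mul_of_nonneg_right (by linarith) hb
    have h2 : ((halfMaxSize M : ℝ) - k) * evenCount M (2 * k) ≤ C * n * evenCount M (2 * k) :=
      mul_le_mul_of_nonneg_right (by linarith [(Nat.cast_nonneg k : (0 : ℝ) ≤ k)]) ha
    have h3 := mul_le_mul_of_nonneg_left h2 hR1.le
    rw [div_mul_eq_mul_div, div_le_iff₀ (by positivity)]
    nlinarith

/-! ### The saddle point equation -/

/-- The mean size of a random even subset of an `r`-element set, weighted with `v ^ size`. -/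
noncomputable def meanSize (r : ℕ) (v : ℝ) : ℝ :=
  r * v * (((1 + v) ^ (r - 1) - (1 - v) ^ (r - 1)) / ((1 + v) ^ r + (1 - v) ^ r))

theorem hasDerivAt_q (r : ℕ) (v : ℝ) :
    HasDerivAt (q r) (r * ((1 + v) ^ (r - 1) - (1 - v) ^ (r - 1)) / 2) v := by
  have h1 : HasDerivAt (fun v : ℝ => (1 + v) ^ r) (r * (1 + v) ^ (r - 1) * 1) v :=
    ((hasDerivAt_id v).const_add 1).pow r
  have h2 : HasDerivAt (fun v : ℝ => (1 - v) ^ r) (r * (1 - v) ^ (r - 1) * (-1)) v :=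
    ((hasDerivAt_id v).const_sub 1).pow r
  refine ((h1.add h2).div_const 2).congr_deriv ?_
  ring

theorem continuous_q (r : ℕ) : Continuous (q r) :=
  continuous_iff_continuousAt.2 fun v => (hasDerivAt_q r v).continuousAt

theorem meanSize_eq (r : ℕ) (v : ℝ) :
    meanSize r v = v * (r * ((1 + v) ^ (r - 1) - (1 - v) ^ (r - 1)) / 2) / q r v := by
  have := (q_pos r v).ne'
  have h2 : (1 + v) ^ r + (1 - v) ^ r = 2 * q r v := by rw [q]; ring
  rw [meanSize, h2]
  field_simp

theorem continuous_meanSize (r : ℕ) : Continuous (meanSize r) := by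
  have : meanSize r = fun v => v * (r * ((1 + v) ^ (r - 1) - (1 - v) ^ (r - 1)) / 2) / q r v :=
    funext (meanSize_eq r)
  rw [this]
  exact Continuous.div (by fun_prop) (continuous_q r) fun v => (q_pos r v).ne'

theorem deriv_q_mul (r : ℕ) (v : ℝ) :
    v * (r * ((1 + v) ^ (r - 1) - (1 - v) ^ (r - 1)) / 2) =
      ∑ k ∈ Finset.range (r / 2 + 1), (2 * k : ℕ) * (r.choose (2 * k) * v ^ (2 * k)) := by
  have h : HasDerivAt (q r) (∑ k ∈ Finset.range (r / 2 + 1),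
      (r.choose (2 * k) : ℝ) * ((2 * k : ℕ) * v ^ (2 * k - 1))) v := by
    have : q r = fun v => ∑ k ∈ Finset.range (r / 2 + 1), (r.choose (2 * k) : ℝ) * v ^ (2 * k) :=
      funext (q_eq_sum r)
    rw [this]
    exact HasDerivAt.fun_sum fun k _ => (hasDerivAt_pow (2 * k) v).const_mul _
  rw [(hasDerivAt_q r v).unique h, Finset.mul_sum]
  refine Finset.sum_congr rfl fun k _ => ?_
  cases k with
  | zero => simp
  | succ k =>
    rw [show 2 * (k + 1) - 1 = 2 * k + 1 by omega, show 2 * (k + 1) = 2 * k + 1 + 1 by ring,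
      pow_succ v (2 * k + 1)]
    ring

theorem meanSize_eq_sum_div (r : ℕ) (v : ℝ) :
    meanSize r v =
      (∑ k ∈ Finset.range (r / 2 + 1), (2 * k : ℕ) * (r.choose (2 * k) * v ^ (2 * k))) /
        q r v := by
  rw [meanSize_eq, deriv_q_mul]

/-- Symmetrisation as in Chebyshev's sum inequality: twice the cross-multiplied difference is the
double sum of the terms F i j, each nonnegative because its two sign-changing factors agree in sign.
For r ≥ 2 the pair (0,1) is strictly positive. -/
theorem meanSize_le_of_lt (r : ℕ) {u v : ℝ} (hu : 0 < u) (huv : u < v) :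
    meanSize r u ≤ meanSize r v ∧ (2 ≤ r → meanSize r u < meanSize r v) := by
  set s := Finset.range (r / 2 + 1) with hs
  set c : ℕ → ℝ := fun k => r.choose (2 * k) with hc
  set F : ℕ → ℕ → ℝ := fun i j => c i * c j * ((2 * j : ℕ) - (2 * i : ℕ)) *
    (u ^ (2 * i) * v ^ (2 * j) - u ^ (2 * j) * v ^ (2 * i)) with hF
  have hle : ∀ i j : ℕ, i ≤ j → 0 ≤ u ^ (2 * i) * v ^ (2 * j) - u ^ (2 * j) * v ^ (2 * i) := by
    intro i j hij
    obtain ⟨m, rfl⟩ := Nat.exists_eq_add_of_le hij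
    have : u ^ (2 * m) ≤ v ^ (2 * m) := pow_le_pow_left₀ hu.le huv.le _
    have h2 : 0 ≤ u ^ (2 * i) * v ^ (2 * i) := by
      have := hu.trans huv
      positivity
    have : u ^ (2 * i) * v ^ (2 * (i + m)) - u ^ (2 * (i + m)) * v ^ (2 * i) =
        u ^ (2 * i) * v ^ (2 * i) * (v ^ (2 * m) - u ^ (2 * m)) := by ring
    rw [this]
    exact mul_nonneg h2 (by linarith)
  have hF0 : ∀ i j, 0 ≤ F i j := by
    intro i j
    have hcc : 0 ≤ c i * c j := by positivity
    obtain hij | hij := le_total i j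
    · have : ((2 * i : ℕ) : ℝ) ≤ (2 * j : ℕ) := by exact_mod_cast (by omega : 2 * i ≤ 2 * j)
      exact mul_nonneg (mul_nonneg hcc (by linarith)) (hle i j hij)
    · have h1 : ((2 * j : ℕ) : ℝ) ≤ (2 * i : ℕ) := by exact_mod_cast (by omega : 2 * j ≤ 2 * i)
      have := mul_nonneg (mul_nonneg hcc (sub_nonneg.2 h1)) (hle j i hij)
      simp only [hF]
      linarith
  have hsum : 2 * ((∑ k ∈ s, (2 * k : ℕ) * (c k * v ^ (2 * k))) * (∑ k ∈ s, c k * u ^ (2 * k)) -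
      (∑ k ∈ s, (2 * k : ℕ) * (c k * u ^ (2 * k))) * (∑ k ∈ s, c k * v ^ (2 * k))) =
      ∑ i ∈ s, ∑ j ∈ s, F i j := by
    have e1 : (∑ k ∈ s, (2 * k : ℕ) * (c k * v ^ (2 * k))) * (∑ k ∈ s, c k * u ^ (2 * k)) =
        ∑ i ∈ s, ∑ j ∈ s, (2 * i : ℕ) * (c i * v ^ (2 * i)) * (c j * u ^ (2 * j)) :=
      Finset.sum_mul_sum _ _ _ _
    have e2 : (∑ k ∈ s, (2 * k : ℕ) * (c k * u ^ (2 * k))) * (∑ k ∈ s, c k * v ^ (2 * k)) =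
        ∑ i ∈ s, ∑ j ∈ s, (2 * i : ℕ) * (c i * u ^ (2 * i)) * (c j * v ^ (2 * j)) :=
      Finset.sum_mul_sum _ _ _ _
    have e3 := e1.trans Finset.sum_comm
    have e4 := e2.trans Finset.sum_comm
    have e5 : ∑ i ∈ s, ∑ j ∈ s, F i j =
        (∑ i ∈ s, ∑ j ∈ s, (2 * j : ℕ) * (c j * v ^ (2 * j)) * (c i * u ^ (2 * i)) -
          ∑ i ∈ s, ∑ j ∈ s, (2 * j : ℕ) * (c j * u ^ (2 * j)) * (c i * v ^ (2 * i))) +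
        (∑ i ∈ s, ∑ j ∈ s, (2 * i : ℕ) * (c i * v ^ (2 * i)) * (c j * u ^ (2 * j)) -
          ∑ i ∈ s, ∑ j ∈ s, (2 * i : ℕ) * (c i * u ^ (2 * i)) * (c j * v ^ (2 * j))) := by
      simp only [← Finset.sum_sub_distrib, ← Finset.sum_add_distrib]
      refine Finset.sum_congr rfl fun i _ => Finset.sum_congr rfl fun j _ => ?_
      simp only [hF]
      ring
    rw [e5, ← e1, ← e2, ← e3, ← e4]
    ring
  rw [meanSize_eq_sum_div, meanSize_eq_sum_div, div_le_div_iff₀ (q_pos r u) (q_pos r v),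
    div_lt_div_iff₀ (q_pos r u) (q_pos r v), q_eq_sum r u, q_eq_sum r v]
  constructor
  · have : 0 ≤ ∑ i ∈ s, ∑ j ∈ s, F i j :=
      Finset.sum_nonneg fun i _ => Finset.sum_nonneg fun j _ => hF0 i j
    linarith
  · intro hr
    have : 0 < ∑ i ∈ s, ∑ j ∈ s, F i j := by
      refine Finset.sum_pos' (fun i _ => Finset.sum_nonneg fun j _ => hF0 i j)
        ⟨0, by simp [hs], Finset.sum_pos' (fun j _ => hF0 0 j) ⟨1, ?_, ?_⟩⟩
      · rw [hs, Finset.mem_range]; omega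
      · have h2 : (0 : ℝ) < r.choose 2 := by exact_mod_cast Nat.choose_pos hr
        have h3 : u ^ 2 < v ^ 2 := pow_lt_pow_left₀ huv hu.le two_ne_zero
        simp only [hF, hc]
        norm_num
        exact mul_pos (mul_pos h2 two_pos) (by linarith)
    linarith

theorem meanSize_le (r : ℕ) (v : ℝ) : meanSize r v ≤ (2 * (r / 2) : ℕ) := by
  rw [meanSize_eq_sum_div, div_le_iff₀ (q_pos r v), q_eq_sum, Finset.mul_sum]
  refine Finset.sum_le_sum fun k hk => ?_
  rw [Finset.mem_range] at hk
  have h : 0 ≤ (r.choose (2 * k) : ℝ) * v ^ (2 * k) :=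
    mul_nonneg (Nat.cast_nonneg _) ((even_two_mul k).pow_nonneg v)
  have h2 : ((2 * k : ℕ) : ℝ) ≤ (2 * (r / 2) : ℕ) := by
    exact_mod_cast (by omega : 2 * k ≤ 2 * (r / 2))
  exact mul_le_mul_of_nonneg_right h2 h

/-- The deficit 2d - `meanSize r v` is a weighted sum of the terms v^{2k} / q_r(v) with k < d. Since
v^{2k+2} ≤ v^{2d} ≤ q_r(v) for v ≥ 1, it is at most C / v². -/
theorem tendsto_meanSize_atTop (r : ℕ) :
    Tendsto (meanSize r) atTop (𝓝 (2 * (r / 2) : ℕ)) := by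
  set d := r / 2 with hd
  set C : ℝ := ∑ k ∈ Finset.range d, ((2 * d : ℕ) - (2 * k : ℕ)) * (r.choose (2 * k) : ℝ)
  have hlow : ∀ v : ℝ, 1 ≤ v → ((2 * d : ℕ) : ℝ) - C / v ^ 2 ≤ meanSize r v := by
    intro v hv
    have hv0 : 0 < v := one_pos.trans_le hv
    have hq : v ^ (2 * d) ≤ q r v := by
      rw [q_eq_sum]
      have h1 : (1 : ℝ) ≤ r.choose (2 * d) := by
        exact_mod_cast Nat.choose_pos (by omega : 2 * d ≤ r)
      refine le_trans ?_ (Finset.single_le_sum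
        (f := fun k => (r.choose (2 * k) : ℝ) * v ^ (2 * k)) (fun k _ => by positivity)
        (Finset.mem_range.2 (Nat.lt_succ_self d)))
      exact le_mul_of_one_le_left (by positivity) h1
    rw [sub_le_comm, meanSize_eq_sum_div, sub_div' (q_pos r v).ne',
      div_le_div_iff₀ (q_pos r v) (by positivity)]
    have h2 : ((2 * d : ℕ) : ℝ) * q r v - ∑ k ∈ Finset.range (d + 1),
        ((2 * k : ℕ) : ℝ) * (r.choose (2 * k) * v ^ (2 * k)) =
        ∑ k ∈ Finset.range d, (((2 * d : ℕ) : ℝ) - (2 * k : ℕ)) *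
          (r.choose (2 * k) * v ^ (2 * k)) := by
      rw [q_eq_sum, Finset.mul_sum, ← Finset.sum_sub_distrib, Finset.sum_range_succ]
      simp only [sub_mul, ← hd]
      ring
    rw [h2]
    calc (∑ k ∈ Finset.range d, (((2 * d : ℕ) : ℝ) - (2 * k : ℕ)) *
          (r.choose (2 * k) * v ^ (2 * k))) * v ^ 2
        ≤ C * v ^ (2 * d) := by
          rw [Finset.sum_mul, Finset.sum_mul]
          refine Finset.sum_le_sum fun k hk => ?_
          rw [Finset.mem_range] at hk
          have hk' : (0 : ℝ) ≤ (2 * d : ℕ) - (2 * k : ℕ) := by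
            rw [sub_nonneg]; exact_mod_cast (by omega : 2 * k ≤ 2 * d)
          rw [mul_assoc, mul_assoc, mul_assoc, ← pow_add]
          exact mul_le_mul_of_nonneg_left (mul_le_mul_of_nonneg_left
            (pow_le_pow_right₀ hv (by omega)) (Nat.cast_nonneg _)) hk'
      _ ≤ C * q r v := by
          refine mul_le_mul_of_nonneg_left hq (Finset.sum_nonneg fun k hk => ?_)
          rw [Finset.mem_range] at hk
          refine mul_nonneg ?_ (Nat.cast_nonneg _)
          rw [sub_nonneg]; exact_mod_cast (by omega : 2 * k ≤ 2 * d)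
  have hlim : Tendsto (fun v : ℝ => ((2 * d : ℕ) : ℝ) - C / v ^ 2) atTop
      (𝓝 (((2 * d : ℕ) : ℝ) - 0)) :=
    (tendsto_const_nhds.div_atTop (tendsto_pow_atTop two_ne_zero)).const_sub _
  rw [sub_zero] at hlim
  refine tendsto_of_tendsto_of_tendsto_of_le_of_le' hlim tendsto_const_nhds ?_ ?_
  · filter_upwards [eventually_ge_atTop 1] with v hv using hlow v hv
  · exact Eventually.of_forall fun v => meanSize_le r v

/-! ### The saddle map of a proper degree distribution -/

/-- Degree distributions with some degree larger than one. -/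
structure IsProperDegreeDist (Γ : ℝ[X]) : Prop extends IsDegreeDist Γ where
  exists_two_le : ∃ r, 2 ≤ r ∧ Γ.coeff r ≠ 0

theorem avgDegree_eq_sum (Γ : ℝ[X]) : avgDegree Γ = Γ.sum fun r g => g * r := by
  rw [avgDegree, Polynomial.derivative_eval]
  simp

theorem saddle_eq_sum (Γ : ℝ[X]) (v : ℝ) :
    saddle Γ v = (Γ.sum fun r g => g * meanSize r v) / avgDegree Γ := by
  rw [saddle, Polynomial.sum, Polynomial.sum, Finset.mul_sum, Finset.sum_div]
  refine Finset.sum_congr rfl fun r _ => ?_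
  rw [meanSize]
  ring

theorem continuous_saddle (Γ : ℝ[X]) : Continuous (saddle Γ) := by
  have : saddle Γ = fun v => (Γ.sum fun r g => g * meanSize r v) / avgDegree Γ :=
    funext (saddle_eq_sum Γ)
  rw [this]
  exact (continuous_finsetSum _ fun r _ => (continuous_meanSize r).const_mul _).div_const _

theorem saddle_zero (Γ : ℝ[X]) : saddle Γ 0 = 0 := by simp [saddle]

namespace IsProperDegreeDist

variable {Γ : ℝ[X]}

theorem avgDegree_pos (hΓ : IsProperDegreeDist Γ) : 0 < avgDegree Γ := by
  obtain ⟨r, hr, hr0⟩ := hΓ.exists_two_le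
  rw [avgDegree_eq_sum]
  refine Finset.sum_pos' (fun i _ => mul_nonneg (hΓ.nonneg i) (Nat.cast_nonneg i))
    ⟨r, Polynomial.mem_support_iff.2 hr0, mul_pos ((hΓ.nonneg r).lt_of_ne' hr0) ?_⟩
  exact_mod_cast (by omega : 0 < r)

theorem maxFraction_eq (hΓ : IsProperDegreeDist Γ) :
    maxFraction Γ = (Γ.sum fun r g => g * (2 * (r / 2) : ℕ)) / avgDegree Γ := by
  rw [maxFraction, eq_div_iff hΓ.avgDegree_pos.ne', sub_mul, one_mul,
    div_mul_cancel₀ _ hΓ.avgDegree_pos.ne', avgDegree_eq_sum, Polynomial.sum, Polynomial.sum,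
    Polynomial.sum, ← Finset.sum_sub_distrib]
  refine Finset.sum_congr rfl fun r _ => ?_
  split_ifs with hr
  · obtain ⟨m, rfl⟩ := hr
    rw [show (2 * m + 1) / 2 = m by omega]
    push_cast; ring
  · rw [Nat.mul_div_cancel' (Nat.not_odd_iff_even.1 hr).two_dvd, sub_zero]

theorem maxFraction_pos (hΓ : IsProperDegreeDist Γ) : 0 < maxFraction Γ := by
  obtain ⟨r, hr, hr0⟩ := hΓ.exists_two_le
  rw [hΓ.maxFraction_eq]
  refine div_pos (Finset.sum_pos' (fun i _ => mul_nonneg (hΓ.nonneg i) (Nat.cast_nonneg _))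
    ⟨r, Polynomial.mem_support_iff.2 hr0, mul_pos ((hΓ.nonneg r).lt_of_ne' hr0) ?_⟩)
    hΓ.avgDegree_pos
  exact_mod_cast (by omega : 0 < 2 * (r / 2))

theorem maxFraction_le_one (hΓ : IsProperDegreeDist Γ) : maxFraction Γ ≤ 1 := by
  rw [maxFraction, sub_le_self_iff]
  refine div_nonneg (Finset.sum_nonneg fun r _ => ?_) hΓ.avgDegree_pos.le
  dsimp only
  split_ifs
  · exact hΓ.nonneg r
  · exact le_rfl

theorem saddle_strictMonoOn (hΓ : IsProperDegreeDist Γ) : StrictMonoOn (saddle Γ) (Ioi 0) := by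
  intro u hu v _ huv
  obtain ⟨r, hr, hr0⟩ := hΓ.exists_two_le
  rw [saddle_eq_sum, saddle_eq_sum]
  refine div_lt_div_of_pos_right (Finset.sum_lt_sum (fun i _ => ?_)
    ⟨r, Polynomial.mem_support_iff.2 hr0, ?_⟩) hΓ.avgDegree_pos
  · exact mul_le_mul_of_nonneg_left (meanSize_le_of_lt i hu huv).1 (hΓ.nonneg i)
  · exact mul_lt_mul_of_pos_left ((meanSize_le_of_lt r hu huv).2 hr)
      ((hΓ.nonneg r).lt_of_ne' hr0)

theorem tendsto_saddle_atTop (hΓ : IsProperDegreeDist Γ) :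
    Tendsto (saddle Γ) atTop (𝓝 (maxFraction Γ)) := by
  have : saddle Γ = fun v => (Γ.sum fun r g => g * meanSize r v) / avgDegree Γ :=
    funext (saddle_eq_sum Γ)
  rw [this, hΓ.maxFraction_eq]
  exact (tendsto_finsetSum _ fun r _ => (tendsto_meanSize_atTop r).const_mul _).div_const _

theorem saddle_lt_maxFraction (hΓ : IsProperDegreeDist Γ)
    {v : ℝ} (hv : 0 < v) : saddle Γ v < maxFraction Γ := by
  refine (hΓ.saddle_strictMonoOn hv (show 0 < v + 1 by linarith) (lt_add_one v)).trans_le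
    (ge_of_tendsto hΓ.tendsto_saddle_atTop ?_)
  filter_upwards [eventually_ge_atTop (v + 1)] with w hw
  exact hΓ.saddle_strictMonoOn.monotoneOn (show 0 < v + 1 by linarith)
    (show 0 < w by linarith) hw

theorem saddle_pos (hΓ : IsProperDegreeDist Γ) {v : ℝ} (hv : 0 < v) : 0 < saddle Γ v := by
  -- Strict monotonicity is known on (0,∞) only, so 0 enters as a limit and v/2 supplies the strict
  -- inequality.
  have h1 : saddle Γ (v / 2) < saddle Γ v :=
    hΓ.saddle_strictMonoOn (half_pos hv) hv (half_lt_self hv)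
  have h2 : Tendsto (saddle Γ) (𝓝[>] 0) (𝓝 0) := by
    have := (continuous_saddle Γ).tendsto 0
    rw [saddle_zero] at this
    exact this.mono_left nhdsWithin_le_nhds
  refine lt_of_le_of_lt (le_of_tendsto h2 ?_) h1
  filter_upwards [Ioo_mem_nhdsGT (half_pos hv)] with w hw
  exact hΓ.saddle_strictMonoOn.monotoneOn hw.1 (half_pos hv) hw.2.le

theorem exists_saddle_eq_iff (hΓ : IsProperDegreeDist Γ) {e : ℝ} :
    (∃ v, 0 < v ∧ saddle Γ v = e) ↔ e ∈ Ioo 0 (maxFraction Γ) := by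
  constructor
  · rintro ⟨v, hv, rfl⟩
    exact ⟨hΓ.saddle_pos hv, hΓ.saddle_lt_maxFraction hv⟩
  · rintro ⟨h0, h1⟩
    obtain ⟨w, hw0, hw⟩ := ((eventually_gt_atTop 0).and
      (hΓ.tendsto_saddle_atTop.eventually_const_lt h1)).exists
    obtain ⟨v, hv, rfl⟩ := intermediate_value_Ioo hw0.le (continuous_saddle Γ).continuousOn
      (show e ∈ Ioo (saddle Γ 0) (saddle Γ w) by rw [saddle_zero]; exact ⟨h0, hw⟩)
    exact ⟨v, hv.1, rfl⟩

theorem existsUnique_saddle_eq (hΓ : IsProperDegreeDist Γ)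
    {e : ℝ} (he : e ∈ Ioo 0 (maxFraction Γ)) :
    ∃! v, 0 < v ∧ saddle Γ v = e := by
  obtain ⟨v, hv, hve⟩ := hΓ.exists_saddle_eq_iff.2 he
  exact ⟨v, ⟨hv, hve⟩, fun w hw => hΓ.saddle_strictMonoOn.injOn hw.1 hv (hw.2.trans hve.symm)⟩

theorem saddleRoot_spec (hΓ : IsProperDegreeDist Γ) {e : ℝ} (he : e ∈ Ioo 0 (maxFraction Γ)) :
    0 < saddleRoot Γ e ∧ saddle Γ (saddleRoot Γ e) = e := by
  have h := hΓ.exists_saddle_eq_iff.2 he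
  rw [saddleRoot, dif_pos h]
  exact h.choose_spec

theorem saddleRoot_eq (hΓ : IsProperDegreeDist Γ)
    {v : ℝ} (hv : 0 < v) : saddleRoot Γ (saddle Γ v) = v := by
  have := hΓ.saddleRoot_spec (hΓ.exists_saddle_eq_iff.1 ⟨v, hv, rfl⟩)
  exact hΓ.saddle_strictMonoOn.injOn this.1 hv this.2

theorem saddleRoot_monotoneOn (hΓ : IsProperDegreeDist Γ) :
    MonotoneOn (saddleRoot Γ) (Ioo 0 (maxFraction Γ)) := by
  intro e he e' he' h
  have h1 := hΓ.saddleRoot_spec he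
  have h2 := hΓ.saddleRoot_spec he'
  rw [← hΓ.saddle_strictMonoOn.le_iff_le h1.1 h2.1, h1.2, h2.2]
  exact h

end IsProperDegreeDist

theorem thetaDomain_eq {Γ₁ Γ₂ : ℝ[X]} (h₁ : IsProperDegreeDist Γ₁) (h₂ : IsProperDegreeDist Γ₂) :
    thetaDomain Γ₁ Γ₂ = Ioo 0 (min (maxFraction Γ₁) (maxFraction Γ₂)) := by
  ext e
  simp only [thetaDomain, mem_ofPred_eq, h₁.exists_saddle_eq_iff, h₂.exists_saddle_eq_iff, mem_Ioo,
    lt_min_iff]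
  have := h₁.maxFraction_le_one
  constructor
  · rintro ⟨-, ⟨h0, h1⟩, -, h2⟩
    exact ⟨h0, h1, h2⟩
  · rintro ⟨h0, h1, h2⟩
    exact ⟨⟨h0, by linarith⟩, ⟨h0, h1⟩, h0, h2⟩

/-! ### The logarithmic generating function -/

/-- The mean of `log (q r v)` over the degree distribution. -/
noncomputable def meanLogQ (Γ : ℝ[X]) (v : ℝ) : ℝ := Γ.sum fun r g => g * Real.log (q r v)

/-- In the variable t = log v the saddle equation is the stationarity condition of the exponent, and
monotonicity of `saddle` becomes convexity. -/
theorem IsProperDegreeDist.hasDerivAt_meanLogQ_exp {Γ : ℝ[X]} (hΓ : IsProperDegreeDist Γ) (t : ℝ) :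
    HasDerivAt (fun t => meanLogQ Γ (Real.exp t)) (avgDegree Γ * saddle Γ (Real.exp t)) t := by
  have h : ∀ r ∈ Γ.support, HasDerivAt (fun t => Γ.coeff r * Real.log (q r (Real.exp t)))
      (Γ.coeff r * meanSize r (Real.exp t)) t := by
    intro r _
    refine ((((hasDerivAt_q r (Real.exp t)).comp t (Real.hasDerivAt_exp t)).log
      (q_pos r _).ne').const_mul (Γ.coeff r)).congr_deriv ?_
    rw [meanSize_eq, Function.comp_apply]
    ring
  refine (HasDerivAt.fun_sum h).congr_deriv ?_
  rw [saddle_eq_sum, mul_div_cancel₀ _ hΓ.avgDegree_pos.ne']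
  rfl

/-- The value at the saddle point is bounded by the value at `v = 1`. -/
theorem IsProperDegreeDist.meanLogQ_sub_le {Γ : ℝ[X]} (hΓ : IsProperDegreeDist Γ) {v : ℝ}
    (hv : 0 < v) :
    meanLogQ Γ v - avgDegree Γ * saddle Γ v * Real.log v ≤ meanLogQ Γ 1 := by
  have hA := hΓ.avgDegree_pos
  have hd := hΓ.hasDerivAt_meanLogQ_exp
  set f := fun t => meanLogQ Γ (Real.exp t) with hf
  set t := Real.log v with ht
  have hexp : Real.exp t = v := Real.exp_log hv
  have hft : meanLogQ Γ v = f t := by simp only [hf, hexp]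
  have hf0 : meanLogQ Γ 1 = f 0 := by simp only [hf, Real.exp_zero]
  have hcont : Continuous f := continuous_iff_continuousAt.2 fun t => (hd t).continuousAt
  have hmono : ∀ s t : ℝ, s ≤ t → avgDegree Γ * saddle Γ (Real.exp s) ≤
      avgDegree Γ * saddle Γ (Real.exp t) := fun s t hst =>
    mul_le_mul_of_nonneg_left (hΓ.saddle_strictMonoOn.monotoneOn (Real.exp_pos s) (Real.exp_pos t)
      (Real.exp_le_exp.2 hst)) hA.le
  rw [hft, hf0, ← hexp]
  -- The claim is that the tangent to f at t lies below f at 0. The derivative of f is monotone, so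
  -- the mean value theorem gives this on either side.
  obtain h | h | h := lt_trichotomy t 0
  · obtain ⟨ξ, hξ, hslope⟩ := exists_hasDerivAt_eq_slope f _ h hcont.continuousOn fun s _ => hd s
    rw [eq_div_iff (by linarith)] at hslope
    nlinarith [hmono t ξ hξ.1.le]
  · rw [h]; simp
  · obtain ⟨ξ, hξ, hslope⟩ := exists_hasDerivAt_eq_slope f _ h hcont.continuousOn fun s _ => hd s
    rw [eq_div_iff (by linarith)] at hslope
    nlinarith [hmono ξ t hξ.2.le]

theorem IsProperDegreeDist.meanLogQ_le {Γ : ℝ[X]} (hΓ : IsProperDegreeDist Γ) {v : ℝ}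
    (hv : 1 ≤ v) :
    meanLogQ Γ v ≤ avgDegree Γ * Real.log 2 + avgDegree Γ * maxFraction Γ * Real.log v := by
  rw [hΓ.maxFraction_eq, mul_div_cancel₀ _ hΓ.avgDegree_pos.ne', avgDegree_eq_sum, meanLogQ,
    Polynomial.sum, Polynomial.sum, Polynomial.sum, Finset.sum_mul, Finset.sum_mul,
    ← Finset.sum_add_distrib]
  refine Finset.sum_le_sum fun r _ => ?_
  rw [mul_assoc, mul_assoc, ← mul_add]
  refine mul_le_mul_of_nonneg_left ?_ (hΓ.nonneg r)
  have hv0 : 0 < v := by linarith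
  rw [← Real.log_pow, ← Real.log_pow, ← Real.log_mul (by positivity) (by positivity)]
  exact Real.log_le_log (q_pos r v) (q_le r hv)

/-! ### Binomial coefficients and entropy -/

/-- The ratio of consecutive terms is (n-i)w / ((i+1)(n-w)), at least 1 for i < w and at most 1 for
i ≥ w. -/
theorem binomial_term_le {n w : ℕ} (hw : w < n) (i : ℕ) (hi : i ≤ n) :
    n.choose i * w ^ i * (n - w) ^ (n - i) ≤ n.choose w * w ^ w * (n - w) ^ (n - w) := by
  set S : ℕ → ℕ := fun i => n.choose i * w ^ i * (n - w) ^ (n - i) with hS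
  have hpos : 0 < n - w := Nat.sub_pos_of_lt hw
  have hstep : ∀ i, i < n → S (i + 1) * ((i + 1) * (n - w)) = S i * ((n - i) * w) := by
    intro i hi
    have h1 := Nat.choose_succ_right_eq n i
    have h2 : n - i = n - (i + 1) + 1 := by omega
    calc S (i + 1) * ((i + 1) * (n - w))
        = (n.choose (i + 1) * (i + 1)) * (w ^ (i + 1) * ((n - w) ^ (n - (i + 1)) * (n - w))) := by
          simp only [hS]; ring
      _ = S i * ((n - i) * w) := by
          rw [h1, ← pow_succ, ← h2]; simp only [hS]; ring
  have hup : ∀ i, i < w → S i ≤ S (i + 1) := by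
    intro i hi
    have h3 : (i + 1) * (n - w) ≤ (n - i) * w := by
      rw [mul_comm (n - i)]
      exact Nat.mul_le_mul hi (by omega)
    refine Nat.le_of_mul_le_mul_right ?_ (Nat.mul_pos (Nat.succ_pos i) hpos)
    rw [hstep i (by omega)]
    exact Nat.mul_le_mul_left _ h3
  have hdown : ∀ i, w ≤ i → i < n → S (i + 1) ≤ S i := by
    intro i hi hin
    have h3 : (n - i) * w ≤ (i + 1) * (n - w) := by
      rw [mul_comm (n - i)]
      exact Nat.mul_le_mul (by omega) (by omega)
    refine Nat.le_of_mul_le_mul_right ?_ (Nat.mul_pos (Nat.succ_pos i) hpos)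
    rw [hstep i hin]
    exact Nat.mul_le_mul_left _ h3
  change S i ≤ S w
  obtain h | h := le_total i w
  · obtain ⟨m, rfl⟩ := Nat.exists_eq_add_of_le h
    have : ∀ j, j ≤ m → S i ≤ S (i + j) := by
      intro j
      induction j with
      | zero => intro _; exact le_rfl
      | succ j ih => intro hj; exact (ih (by omega)).trans (hup (i + j) (by omega))
    exact this m le_rfl
  · obtain ⟨m, rfl⟩ := Nat.exists_eq_add_of_le h
    have : ∀ j, j ≤ m → S (w + j) ≤ S w := by
      intro j
      induction j with
      | zero => intro _; exact le_rfl
      | succ j ih =>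
        intro hj
        exact (hdown (w + j) (by omega) (by omega)).trans (ih (by omega))
    exact this m le_rfl

/-- The n + 1 terms of (w + (n-w))^n sum to n^n, and the one of index w is the largest; it therefore
lies between n^n/(n+1) and n^n. -/
theorem log_choose_bounds {n w : ℕ} (hw : w ≤ n) :
    n * Real.binEntropy (w / n) - Real.log (n + 1) ≤ Real.log (n.choose w) ∧
      Real.log (n.choose w) ≤ n * Real.binEntropy (w / n) := by
  have hlog : 0 ≤ Real.log ((n : ℝ) + 1) :=
    Real.log_nonneg (by linarith [(Nat.cast_nonneg n : (0 : ℝ) ≤ n)])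
  obtain rfl | hwn := hw.eq_or_lt
  · obtain rfl | hw0 := Nat.eq_zero_or_pos w
    · simp
    · have : (w : ℝ) ≠ 0 := by positivity
      simpa [div_self this] using hlog
  obtain rfl | hw0 := Nat.eq_zero_or_pos w
  · simpa using hlog
  set S : ℕ → ℕ := fun i => n.choose i * w ^ i * (n - w) ^ (n - i) with hS
  have hn0 : 0 < n := by omega
  have hsum : ∑ i ∈ Finset.range (n + 1), S i = n ^ n := by
    have := add_pow w (n - w) n
    rw [Nat.add_sub_cancel' hw] at this
    rw [this]
    refine Finset.sum_congr rfl fun i _ => ?_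
    simp only [hS, Nat.cast_id]
    ring
  have h1 : S w ≤ n ^ n := by
    rw [← hsum]
    exact Finset.single_le_sum (f := S) (fun _ _ => Nat.zero_le _) (by simp; omega)
  have h2 : n ^ n ≤ (n + 1) * S w := by
    rw [← hsum]
    refine (Finset.sum_le_card_nsmul _ _ (S w) fun i hi => ?_).trans_eq (by simp)
    exact binomial_term_le hwn i (by simpa [Nat.lt_succ_iff] using hi)
  have hc : 0 < n.choose w := Nat.choose_pos hw
  have hnR : (0 : ℝ) < n := by exact_mod_cast hn0
  have hwR : (0 : ℝ) < w := by exact_mod_cast hw0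
  have hnw : (0 : ℝ) < n - w := by rw [sub_pos]; exact_mod_cast hwn
  have hcR : (0 : ℝ) < n.choose w := by exact_mod_cast hc
  have hent : n * Real.binEntropy (w / n) =
      n * Real.log n - w * Real.log w - (n - w) * Real.log (n - w) := by
    have h3 : (1 : ℝ) - w / n = (n - w) / n := by field_simp
    rw [Real.binEntropy, h3, inv_div, inv_div, Real.log_div hnR.ne' hwR.ne',
      Real.log_div hnR.ne' hnw.ne']
    field_simp
    ring
  have hSlog : Real.log (S w) = Real.log (n.choose w) + w * Real.log w +
      (n - w) * Real.log (n - w) := by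
    simp only [hS]
    push_cast [Nat.cast_sub hw]
    rw [Real.log_mul (by positivity) (by positivity), Real.log_mul (by positivity) (by positivity),
      Real.log_pow, Real.log_pow, Nat.cast_sub hw]
  have hSpos : (0 : ℝ) < S w := by
    have : 0 < n - w := by omega
    have : 0 < S w := by positivity
    exact_mod_cast this
  have h1' := Real.log_le_log hSpos (show ((S w : ℕ) : ℝ) ≤ (n : ℝ) ^ n by exact_mod_cast h1)
  have h2' := Real.log_le_log (by positivity)
    (show ((n : ℝ) ^ n) ≤ ((n : ℝ) + 1) * (S w : ℕ) by exact_mod_cast h2)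
  rw [Real.log_mul (by positivity) hSpos.ne'] at h2'
  rw [Real.log_pow] at h1' h2'
  rw [hent]
  constructor <;> linarith

theorem binEntropy₂_mul_log_two (x : ℝ) : binEntropy₂ x * Real.log 2 = Real.binEntropy x := by
  have : Real.log 2 ≠ 0 := (Real.log_pos one_lt_two).ne'
  rw [binEntropy₂, Real.binEntropy, Real.logb, Real.logb, Real.log_inv, Real.log_inv]
  field_simp
  ring

/-! ### Asymptotics for the check nodes of one type -/

theorem tendsto_log_mul_add_one_div {n : ℕ → ℕ} (hn : Tendsto n atTop atTop) {l : ℕ} (hl : 1 ≤ l) :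
    Tendsto (fun k => Real.log ((n k * l : ℕ) + 1) / n k) atTop (𝓝 0) := by
  have hnR : Tendsto (fun k => (n k : ℝ)) atTop atTop := tendsto_natCast_atTop_atTop.comp hn
  have hlR : (0 : ℝ) < l := by exact_mod_cast hl
  have hy : Tendsto (fun k => ((n k * l : ℕ) : ℝ) + 1) atTop atTop := by
    push_cast
    exact tendsto_atTop_add_const_right _ _ (hnR.atTop_mul_const hlR)
  have h1 := Real.isLittleO_log_id_atTop.tendsto_div_nhds_zero.comp hy
  have h2 : Tendsto (fun k => (l : ℝ) + 1 / n k) atTop (𝓝 (l + 0)) :=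
    (tendsto_const_nhds.div_atTop hnR).const_add _
  have h3 := h1.mul h2
  rw [zero_mul] at h3
  refine h3.congr' ?_
  filter_upwards [hn.eventually_gt_atTop 0] with k hk
  have hk' : (0 : ℝ) < n k := by exact_mod_cast hk
  have : ((n k * l : ℕ) : ℝ) + 1 ≠ 0 := by positivity
  have h4 : (l : ℝ) + 1 / n k = (((n k * l : ℕ) : ℝ) + 1) / n k := by
    push_cast; field_simp
  rw [h4]
  simp only [Function.comp_apply, id]
  field_simp

theorem log_prod_q (M : ℕ →₀ ℕ) (v : ℝ) :
    Real.log (M.prod fun r m => q r v ^ m) = M.sum fun r m => m * Real.log (q r v) := by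
  rw [Finsupp.prod, Real.log_prod fun r _ => (pow_pos (q_pos r v) _).ne']
  simp [Finsupp.sum]

theorem prod_q_pos (M : ℕ →₀ ℕ) (v : ℝ) : 0 < M.prod fun r m => q r v ^ m :=
  Finset.prod_pos fun r _ => pow_pos (q_pos r v) _

theorem log_evenCount_le {M : ℕ →₀ ℕ} {s : ℕ} (hs : 0 < evenCount M s) {v : ℝ} (hv : 0 < v) :
    Real.log (evenCount M s) ≤ Real.log (M.prod fun r m => q r v ^ m) - s * Real.log v := by
  have hs' : (0 : ℝ) < evenCount M s := by exact_mod_cast hs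
  have := Real.log_le_log (by positivity) (evenCount_mul_pow_le M s hv)
  rw [Real.log_mul (by positivity) (by positivity), Real.log_pow] at this
  linarith

namespace FollowsDegreeDist

variable {l : ℕ} {Γ : ℝ[X]} {n : ℕ → ℕ} {M : ℕ → ℕ →₀ ℕ}

theorem comp (hM : FollowsDegreeDist l Γ n M) {φ : ℕ → ℕ} (hφ : Tendsto φ atTop atTop) :
    FollowsDegreeDist l Γ (n ∘ φ) (M ∘ φ) :=
  ⟨fun k => hM.edges (φ k), fun k => hM.support (φ k), fun r => (hM.tendsto r).comp hφ⟩

theorem tendsto_sum (hM : FollowsDegreeDist l Γ n M) (f : ℕ → ℝ) :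
    Tendsto (fun k => ((M k).sum fun r m => m * f r) / n k) atTop
      (𝓝 (l / avgDegree Γ * Γ.sum fun r g => g * f r)) := by
  have h : Tendsto (fun k => ∑ r ∈ Γ.support, (M k r : ℝ) / n k * f r) atTop
      (𝓝 (∑ r ∈ Γ.support, Γ.coeff r * l / avgDegree Γ * f r)) :=
    tendsto_finsetSum _ fun r _ => (hM.tendsto r).mul_const _
  have e1 : l / avgDegree Γ * (Γ.sum fun r g => g * f r) =
      ∑ r ∈ Γ.support, Γ.coeff r * l / avgDegree Γ * f r := by
    rw [Polynomial.sum, Finset.mul_sum]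
    exact Finset.sum_congr rfl fun r _ => by ring
  rw [e1]
  refine h.congr fun k => ?_
  rw [Finsupp.sum_of_support_subset _ (hM.support k) _ (by simp), Finset.sum_div]
  exact Finset.sum_congr rfl fun r _ => by ring

theorem tendsto_log_prod_q (hM : FollowsDegreeDist l Γ n M) (v : ℝ) :
    Tendsto (fun k => Real.log ((M k).prod fun r m => q r v ^ m) / n k) atTop
      (𝓝 (l / avgDegree Γ * meanLogQ Γ v)) := by
  simp only [log_prod_q]
  exact hM.tendsto_sum fun r => Real.log (q r v)

theorem tendsto_halfMaxSize (hM : FollowsDegreeDist l Γ n M) (hΓ : IsProperDegreeDist Γ) :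
    Tendsto (fun k => (halfMaxSize (M k) : ℝ) / n k) atTop (𝓝 (l * maxFraction Γ / 2)) := by
  have h := hM.tendsto_sum fun r => ((r / 2 : ℕ) : ℝ)
  have e1 : l * maxFraction Γ / 2 = l / avgDegree Γ * Γ.sum fun r g => g * ((r / 2 : ℕ) : ℝ) := by
    have : (Γ.sum fun r g => g * ((2 * (r / 2) : ℕ) : ℝ)) =
        2 * Γ.sum fun r g => g * ((r / 2 : ℕ) : ℝ) := by
      rw [Polynomial.sum, Polynomial.sum, Finset.mul_sum]
      refine Finset.sum_congr rfl fun r _ => ?_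
      push_cast; ring
    rw [hΓ.maxFraction_eq, this]
    ring
  rw [e1]
  refine h.congr fun k => ?_
  rw [halfMaxSize, Finsupp.sum, Finsupp.sum]
  push_cast
  rfl

/-- The largest terms of the generating functions concentrate at the saddle point. -/
theorem tendsto_argmax (hM : FollowsDegreeDist l Γ n M) (hΓ : IsProperDegreeDist Γ) (hl : 1 ≤ l)
    (hn : Tendsto n atTop atTop) {v : ℝ} (hv : 0 < v) {K : ℕ → ℕ}
    (hK : ∀ k, ((M k).prod fun r m => q r v ^ m) ≤
      ((n k * l : ℕ) + 1) * (evenCount (M k) (2 * K k) * v ^ (2 * K k))) :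
    Tendsto (fun k => 2 * (K k : ℝ) / n k) atTop (𝓝 (l * saddle Γ v)) := by
  set t := Real.log v with ht
  have hexp : Real.exp t = v := Real.exp_log hv
  set f := fun t => l / avgDegree Γ * meanLogQ Γ (Real.exp t) with hf
  have hd : HasDerivAt f (l * saddle Γ v) t := by
    refine ((hΓ.hasDerivAt_meanLogQ_exp t).const_mul (l / avgDegree Γ)).congr_deriv ?_
    rw [hexp, ← mul_assoc, div_mul_cancel₀ _ hΓ.avgDegree_pos.ne']
  -- The coefficient bound at e^{t'}, applied to the term that is maximal at e^t, shows that 2K/n is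
  -- asymptotically a subgradient of f at t. Dividing by t' - t of either sign squeezes it to the
  -- derivative.
  have hbound : ∀ t', ∃ E : ℕ → ℝ, Tendsto E atTop (𝓝 (f t' - f t)) ∧
      ∀ᶠ k in atTop, 2 * (K k : ℝ) / n k * (t' - t) ≤ E k := by
    intro t'
    refine ⟨fun k => Real.log ((M k).prod fun r m => q r (Real.exp t') ^ m) / n k -
      Real.log ((M k).prod fun r m => q r (Real.exp t) ^ m) / n k +
      Real.log ((n k * l : ℕ) + 1) / n k, ?_, ?_⟩
    · have := ((hM.tendsto_log_prod_q (Real.exp t')).sub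
        (hM.tendsto_log_prod_q (Real.exp t))).add (tendsto_log_mul_add_one_div hn hl)
      simpa using this
    · filter_upwards [hn.eventually_gt_atTop 0] with k hk
      have hk' : (0 : ℝ) < n k := by exact_mod_cast hk
      have hpos := (prod_q_pos (M k) v).trans_le (hK k)
      have hcount : 0 < evenCount (M k) (2 * K k) := by
        rw [pos_iff_ne_zero]
        intro h0
        simp [h0] at hpos
      have hcount' : (0 : ℝ) < evenCount (M k) (2 * K k) := by exact_mod_cast hcount
      have h1 := Real.log_le_log (prod_q_pos (M k) v) (hK k)
      rw [Real.log_mul (by positivity) (by positivity), Real.log_mul (by positivity)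
        (by positivity), Real.log_pow, ← ht] at h1
      have h2 := log_evenCount_le hcount (Real.exp_pos t')
      rw [Real.log_exp] at h2
      push_cast at h1 h2
      rw [← sub_div, ← add_div, div_mul_eq_mul_div]
      refine div_le_div_of_nonneg_right ?_ hk'.le
      rw [hexp]
      push_cast
      linarith
  have hs := hasDerivAt_iff_tendsto_slope.1 hd
  refine tendsto_order.2 ⟨fun a ha => ?_, fun b hb => ?_⟩
  · have h1 : ∀ᶠ t' in 𝓝[<] t, a < slope f t t' :=
      (hs.eventually_const_lt ha).filter_mono (nhdsWithin_mono _ fun x hx => ne_of_lt hx)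
    obtain ⟨t', h2, h3⟩ := (h1.and self_mem_nhdsWithin).exists
    have h3' : t' - t < 0 := sub_neg.2 h3
    rw [slope_def_field, lt_div_iff_of_neg h3'] at h2
    obtain ⟨E, hE, hEK⟩ := hbound t'
    filter_upwards [hE.eventually_lt_const h2, hEK] with k h4 h5
    exact lt_of_mul_lt_mul_of_nonpos_right (h5.trans_lt h4) h3'.le
  · have h1 : ∀ᶠ t' in 𝓝[>] t, slope f t t' < b :=
      (hs.eventually_lt_const hb).filter_mono (nhdsWithin_mono _ fun x hx => ne_of_gt hx)
    obtain ⟨t', h2, h3⟩ := (h1.and self_mem_nhdsWithin).exists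
    have h3' : 0 < t' - t := sub_pos.2 h3
    rw [slope_def_field, div_lt_iff₀ h3'] at h2
    obtain ⟨E, hE, hEK⟩ := hbound t'
    filter_upwards [hE.eventually_lt_const h2, hEK] with k h4 h5
    exact lt_of_mul_lt_mul_right (h5.trans_lt h4) h3'.le

/-- The exponential growth rate of the number of even sets is at least its value at the saddle
point. -/
theorem eventually_le_log_evenCount (hM : FollowsDegreeDist l Γ n M) (hΓ : IsProperDegreeDist Γ)
    (hl : 1 ≤ l) (hn : Tendsto n atTop atTop) {v : ℝ} (hv : 0 < v) {u : ℕ → ℕ}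
    (hu : Tendsto (fun k => 2 * (u k : ℝ) / n k) atTop (𝓝 (saddle Γ v))) {η : ℝ} (hη : 0 < η) :
    ∀ᶠ k in atTop, 0 < evenCount (M k) (2 * (u k * l)) ∧
      l / avgDegree Γ * meanLogQ Γ v - saddle Γ v * l * Real.log v - η ≤
        Real.log (evenCount (M k) (2 * (u k * l))) / n k := by
  choose K hK using fun k => exists_evenCount_ge (M k) v
  simp only [hM.edges] at hK
  have hKlim := hM.tendsto_argmax hΓ hl hn hv hK
  set e := saddle Γ v with he
  have he0 : 0 < e := hΓ.saddle_pos hv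
  have he1 : e < maxFraction Γ := hΓ.saddle_lt_maxFraction hv
  have hlR : (0 : ℝ) < l := by exact_mod_cast hl
  have hulim : Tendsto (fun k => 2 * ((u k * l : ℕ) : ℝ) / n k) atTop (𝓝 (l * e)) := by
    refine (hu.const_mul (l : ℝ)).congr fun k => ?_
    push_cast; ring
  -- The quarter ensures that indices asymptotic to n l e / 2 end up at distance more than δ n from
  -- both 0 and `halfMaxSize`.
  set δ : ℝ := min (l * e) (l * (maxFraction Γ - e)) / 4 with hδ
  have hδ0 : 0 < δ := by
    have : 0 < maxFraction Γ - e := sub_pos.2 he1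
    positivity
  have hδ1 : 4 * δ ≤ l * e := by rw [hδ]; linarith [min_le_left (l * e) (l * (maxFraction Γ - e))]
  have hδ2 : 4 * δ ≤ l * (maxFraction Γ - e) := by
    rw [hδ]; linarith [min_le_right (l * e) (l * (maxFraction Γ - e))]
  set C : ℝ := l * maxFraction Γ with hC
  have hC0 : 0 < C := mul_pos hlR hΓ.maxFraction_pos
  have hhalf := hM.tendsto_halfMaxSize hΓ
  set c : ℝ := δ / ((2 * (Γ.natDegree : ℕ) + 1) * C) with hc
  have hc0 : 0 < c := by positivity
  -- B is the lower bound obtained by moving from index K to u l. Its first summand is the cost of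
  -- the move and tends to 0, both indices having the same asymptotics.
  set B : ℕ → ℝ := fun k => |2 * (K k : ℝ) / n k - 2 * ((u k * l : ℕ) : ℝ) / n k| / 2 * Real.log c +
    Real.log ((M k).prod fun r m => q r v ^ m) / n k - Real.log ((n k * l : ℕ) + 1) / n k -
    2 * (K k : ℝ) / n k * Real.log v with hB
  have hBlim : Tendsto B atTop (𝓝 (l / avgDegree Γ * meanLogQ Γ v - e * l * Real.log v)) := by
    have := (((((hKlim.sub hulim).abs.div_const 2).mul_const (Real.log c)).add
      (hM.tendsto_log_prod_q v)).sub (tendsto_log_mul_add_one_div hn hl)).sub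
      (hKlim.mul_const (Real.log v))
    convert this using 2
    rw [sub_self, abs_zero]
    ring
  have hR : ∀ k, ∀ r ∈ (M k).support, r ≤ Γ.natDegree := fun k r hr =>
    Polynomial.le_natDegree_of_mem_supp r (hM.support k hr)
  have hlow : ∀ {x : ℕ → ℕ}, Tendsto (fun k => 2 * (x k : ℝ) / n k) atTop (𝓝 (l * e)) →
      ∀ᶠ k in atTop, δ * n k ≤ x k ∧ (x k : ℝ) ≤ halfMaxSize (M k) - δ * n k := by
    intro x hx
    filter_upwards [hx.eventually_const_lt (show 2 * δ < l * e by linarith),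
      (hhalf.sub (hx.div_const 2)).eventually_const_lt
        (show δ < l * maxFraction Γ / 2 - l * e / 2 by linarith),
      hn.eventually_gt_atTop 0] with k h1 h2 hk
    have hk' : (0 : ℝ) < n k := by exact_mod_cast hk
    rw [lt_div_iff₀ hk'] at h1
    have h3 : (halfMaxSize (M k) : ℝ) / n k - 2 * (x k : ℝ) / n k / 2 =
        (halfMaxSize (M k) - x k) / n k := by ring
    rw [h3, lt_div_iff₀ hk'] at h2
    constructor <;> linarith
  filter_upwards [hlow hKlim, hlow hulim, hn.eventually_gt_atTop 0,
    hhalf.eventually_lt_const (show l * maxFraction Γ / 2 < C by linarith),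
    hBlim.eventually_const_lt (sub_lt_self _ hη)] with k h1 h2 hk h3 h4
  have hk' : (0 : ℝ) < n k := by exact_mod_cast hk
  rw [div_lt_iff₀ hk'] at h3
  have h5 := evenCount_comparable (hR k) hδ0 hC0 hk' h3.le h1.1 h1.2 h2.1 h2.2
  rw [← hc] at h5
  have hpos := (prod_q_pos (M k) v).trans_le (hK k)
  have hcount : 0 < evenCount (M k) (2 * K k) := by
    rw [pos_iff_ne_zero]
    intro h0
    simp [h0] at hpos
  have hcount' : (0 : ℝ) < evenCount (M k) (2 * K k) := by exact_mod_cast hcount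
  have hcount2 : (0 : ℝ) < evenCount (M k) (2 * (u k * l)) :=
    lt_of_lt_of_le (by positivity) h5
  refine ⟨by exact_mod_cast hcount2, h4.le.trans ?_⟩
  have h6 := Real.log_le_log (by positivity) h5
  rw [Real.log_mul (by positivity) (by positivity), Real.log_pow] at h6
  have h7 := Real.log_le_log (prod_q_pos (M k) v) (hK k)
  rw [Real.log_mul (by positivity) (by positivity), Real.log_mul (by positivity)
    (by positivity), Real.log_pow] at h7
  have h8 : ((max (K k) (u k * l) - min (K k) (u k * l) : ℕ) : ℝ) =
      |(K k : ℝ) - (u k * l : ℕ)| := by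
    rw [Nat.cast_sub min_le_max, Nat.cast_max, Nat.cast_min, max_sub_min_eq_abs']
  have h9 : |2 * (K k : ℝ) / n k - 2 * ((u k * l : ℕ) : ℝ) / n k| / 2 =
      |(K k : ℝ) - (u k * l : ℕ)| / n k := by
    rw [← sub_div, ← mul_sub, abs_div, abs_mul, abs_of_pos hk', abs_two]
    ring
  rw [h8] at h6
  simp only [hB]
  rw [h9, div_mul_eq_mul_div, div_mul_eq_mul_div, ← add_div, ← sub_div, ← sub_div]
  refine div_le_div_of_nonneg_right ?_ hk'.le
  push_cast at h6 h7 ⊢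
  linarith

end FollowsDegreeDist

/-! ### The growth rate of the expected number of codewords -/

/-- The exponent (in nats) of the expected number of codewords of relative weight `e`, as a function
of the saddle point parameters. -/
noncomputable def exponent (l₁ l₂ : ℕ) (Γ₁ Γ₂ : ℝ[X]) (e v₁ v₂ : ℝ) : ℝ :=
  (1 - l₁ - l₂) * Real.binEntropy e
    + (l₁ / avgDegree Γ₁ * meanLogQ Γ₁ v₁ - e * l₁ * Real.log v₁)
    + (l₂ / avgDegree Γ₂ * meanLogQ Γ₂ v₂ - e * l₂ * Real.log v₂)

theorem meanLogQ_logb (Γ : ℝ[X]) (v : ℝ) :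
    (Γ.sum fun r g => g * Real.logb 2 (q r v)) = meanLogQ Γ v / Real.log 2 := by
  rw [meanLogQ, Polynomial.sum, Polynomial.sum, Finset.sum_div]
  exact Finset.sum_congr rfl fun r _ => by rw [Real.logb, mul_div_assoc]

theorem theta_eq (l₁ l₂ : ℕ) (Γ₁ Γ₂ : ℝ[X]) (e : ℝ) :
    theta l₁ l₂ Γ₁ Γ₂ e = exponent l₁ l₂ Γ₁ Γ₂ e (saddleRoot Γ₁ e) (saddleRoot Γ₂ e) / Real.log 2
      - designRate l₁ l₂ Γ₁ Γ₂ := by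
  have : Real.log 2 ≠ 0 := (Real.log_pos one_lt_two).ne'
  rw [theta, exponent, meanLogQ_logb, meanLogQ_logb, ← binEntropy₂_mul_log_two, Real.logb,
    Real.logb]
  field_simp
  ring

section

variable {l₁ l₂ : ℕ} {Γ₁ Γ₂ : ℝ[X]} {n : ℕ → ℕ} {M₁ M₂ : ℕ → ℕ →₀ ℕ}

theorem weightTerm_nonneg (n l₁ l₂ : ℕ) (M₁ M₂ : ℕ →₀ ℕ) (w : ℕ) :
    0 ≤ weightTerm n l₁ l₂ M₁ M₂ w := by
  rw [weightTerm]; positivity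

theorem log_weightTerm {n l₁ l₂ : ℕ} {M₁ M₂ : ℕ →₀ ℕ} {w : ℕ} (hw : w ≤ n)
    (h₁ : 0 < evenCount M₁ (w * l₁)) (h₂ : 0 < evenCount M₂ (w * l₂)) :
    0 < weightTerm n l₁ l₂ M₁ M₂ w ∧ Real.log (weightTerm n l₁ l₂ M₁ M₂ w) =
      Real.log (n.choose w) +
        (Real.log (evenCount M₁ (w * l₁)) - Real.log ((n * l₁).choose (w * l₁))) +
        (Real.log (evenCount M₂ (w * l₂)) - Real.log ((n * l₂).choose (w * l₂))) := by
  have hc : ∀ l, (0 : ℝ) < (n * l).choose (w * l) := fun l => by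
    exact_mod_cast Nat.choose_pos (Nat.mul_le_mul_right l hw)
  have hc1 := hc l₁
  have hc2 := hc l₂
  have hc0 : (0 : ℝ) < n.choose w := by exact_mod_cast Nat.choose_pos hw
  have h₁' : (0 : ℝ) < evenCount M₁ (w * l₁) := by exact_mod_cast h₁
  have h₂' : (0 : ℝ) < evenCount M₂ (w * l₂) := by exact_mod_cast h₂
  rw [weightTerm]
  refine ⟨by positivity, ?_⟩
  rw [Real.log_mul (by positivity) (by positivity), Real.log_mul (by positivity) (by positivity),
    Real.log_div (by positivity) (by positivity), Real.log_div (by positivity) (by positivity)]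

theorem log_choose_mul_bounds {n w l : ℕ} (hw : w ≤ n) (hl : 1 ≤ l) :
    n * l * Real.binEntropy (w / n) - Real.log ((n * l : ℕ) + 1) ≤
        Real.log ((n * l).choose (w * l)) ∧
      Real.log ((n * l).choose (w * l)) ≤ n * l * Real.binEntropy (w / n) := by
  have h := log_choose_bounds (Nat.mul_le_mul_right l hw)
  have hl' : (l : ℝ) ≠ 0 := by positivity
  have e1 : (((w * l : ℕ) : ℝ) / (n * l : ℕ)) = w / n := by
    push_cast; rw [mul_div_mul_right _ _ hl']
  rw [e1] at h
  push_cast at h ⊢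
  exact h

/-- The parameters v₁, v₂ need not solve the saddle equations, so e may lie outside the domain of θ.
-/
theorem eventually_weightTerm_le (hl₁ : 1 ≤ l₁) (hl₂ : 1 ≤ l₂) (hn : Tendsto n atTop atTop)
    (hM₁ : FollowsDegreeDist l₁ Γ₁ n M₁) (hM₂ : FollowsDegreeDist l₂ Γ₂ n M₂) {w : ℕ → ℕ}
    (hw : ∀ k, w k ≤ n k) {e : ℝ} (he : Tendsto (fun k => (w k : ℝ) / n k) atTop (𝓝 e))
    {v₁ v₂ : ℝ} (hv₁ : 0 < v₁) (hv₂ : 0 < v₂) {b : ℝ} (hb : exponent l₁ l₂ Γ₁ Γ₂ e v₁ v₂ < b) :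
    ∀ᶠ k in atTop, weightTerm (n k) l₁ l₂ (M₁ k) (M₂ k) (w k) ≤ Real.exp (n k * b) := by
  have hH : Tendsto (fun k => Real.binEntropy ((w k : ℝ) / n k)) atTop (𝓝 (Real.binEntropy e)) :=
    (Real.binEntropy_continuous.tendsto e).comp he
  have hlim : ∀ {l : ℕ} {Γ : ℝ[X]} {M : ℕ → ℕ →₀ ℕ}, 1 ≤ l → FollowsDegreeDist l Γ n M → ∀ v : ℝ,
      Tendsto (fun k => Real.log ((M k).prod fun r m => q r v ^ m) / n k -
        (w k : ℝ) / n k * l * Real.log v - l * Real.binEntropy ((w k : ℝ) / n k) +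
        Real.log ((n k * l : ℕ) + 1) / n k) atTop
        (𝓝 (l / avgDegree Γ * meanLogQ Γ v - e * l * Real.log v - l * Real.binEntropy e + 0)) :=
    fun hl hM v => (((hM.tendsto_log_prod_q v).sub ((he.mul_const _).mul_const _)).sub
      (hH.const_mul _)).add (tendsto_log_mul_add_one_div hn hl)
  have htot := (hH.add (hlim hl₁ hM₁ v₁)).add (hlim hl₂ hM₂ v₂)
  have hval : Real.binEntropy e + (l₁ / avgDegree Γ₁ * meanLogQ Γ₁ v₁ - e * l₁ * Real.log v₁ -
      l₁ * Real.binEntropy e + 0) + (l₂ / avgDegree Γ₂ * meanLogQ Γ₂ v₂ - e * l₂ * Real.log v₂ -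
      l₂ * Real.binEntropy e + 0) = exponent l₁ l₂ Γ₁ Γ₂ e v₁ v₂ := by
    rw [exponent]; ring
  rw [hval] at htot
  filter_upwards [htot.eventually_lt_const hb, hn.eventually_gt_atTop 0] with k h1 hk
  have hk' : (0 : ℝ) < n k := by exact_mod_cast hk
  -- A vanishing count makes the whole term zero; logarithms may be taken only in the remaining
  -- case.
  obtain h₁ | h₁ := Nat.eq_zero_or_pos (evenCount (M₁ k) (w k * l₁))
  · simp [weightTerm, h₁, Real.exp_nonneg]
  obtain h₂ | h₂ := Nat.eq_zero_or_pos (evenCount (M₂ k) (w k * l₂))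
  · simp [weightTerm, h₂, Real.exp_nonneg]
  obtain ⟨hpos, hlog⟩ := log_weightTerm (hw k) h₁ h₂
  rw [← Real.log_le_iff_le_exp hpos, hlog]
  have a1 := log_evenCount_le h₁ hv₁
  have a2 := log_evenCount_le h₂ hv₂
  have b1 := (log_choose_mul_bounds (hw k) hl₁).1
  have b2 := (log_choose_mul_bounds (hw k) hl₂).1
  have b0 := (log_choose_bounds (hw k)).2
  have h2 := mul_lt_mul_of_pos_left h1 hk'
  have expand : ∀ (l : ℕ) (P v H L : ℝ), (n k : ℝ) * (P / n k - (w k : ℝ) / n k * l * Real.log v -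
      l * H + L / n k) = P - ((w k * l : ℕ) : ℝ) * Real.log v - n k * l * H + L := by
    intro l P v H L
    push_cast
    field_simp
  rw [mul_add, mul_add, expand, expand] at h2
  linarith

theorem eventually_le_weightTerm (hΓ₁ : IsProperDegreeDist Γ₁) (hΓ₂ : IsProperDegreeDist Γ₂)
    (hl₁ : 1 ≤ l₁) (hl₂ : 1 ≤ l₂) (hn : Tendsto n atTop atTop)
    (hM₁ : FollowsDegreeDist l₁ Γ₁ n M₁) (hM₂ : FollowsDegreeDist l₂ Γ₂ n M₂) {e : ℝ}
    (he : e ∈ thetaDomain Γ₁ Γ₂) {b : ℝ}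
    (hb : b < exponent l₁ l₂ Γ₁ Γ₂ e (saddleRoot Γ₁ e) (saddleRoot Γ₂ e)) :
    ∀ᶠ k in atTop, ∃ w ≤ n k, Real.exp (n k * b) ≤ weightTerm (n k) l₁ l₂ (M₁ k) (M₂ k) w := by
  have he' := he
  rw [thetaDomain_eq hΓ₁ hΓ₂] at he'
  obtain ⟨hv₁, hs₁⟩ := hΓ₁.saddleRoot_spec ⟨he'.1, he'.2.trans_le (min_le_left _ _)⟩
  obtain ⟨hv₂, hs₂⟩ := hΓ₂.saddleRoot_spec ⟨he'.1, he'.2.trans_le (min_le_right _ _)⟩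
  set v₁ := saddleRoot Γ₁ e
  set v₂ := saddleRoot Γ₂ e
  have he0 : 0 < e := he.1.1
  have he1 : e < 1 := he.1.2
  have hnR : Tendsto (fun k => (n k : ℝ)) atTop atTop := tendsto_natCast_atTop_atTop.comp hn
  -- The weights 2u are even, so w l_j is even for both types; even sets of odd size do not exist.
  set u : ℕ → ℕ := fun k => ⌊e / 2 * n k⌋₊ with hu
  have hulim : Tendsto (fun k => 2 * (u k : ℝ) / n k) atTop (𝓝 e) := by
    have := ((tendsto_nat_floor_mul_div_atTop (show 0 ≤ e / 2 by linarith)).comp hnR).const_mul 2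
    rw [mul_div_cancel₀ e two_ne_zero] at this
    refine this.congr fun k => ?_
    simp only [hu, Function.comp_apply]
    ring
  have hle : ∀ k, 2 * u k ≤ n k := by
    intro k
    have h1 : (u k : ℝ) ≤ e / 2 * n k := Nat.floor_le (by positivity)
    have h2 : 2 * (u k : ℝ) ≤ n k := by
      nlinarith [(Nat.cast_nonneg (n k) : (0 : ℝ) ≤ n k)]
    exact_mod_cast h2
  have hulim' : Tendsto (fun k => ((2 * u k : ℕ) : ℝ) / n k) atTop (𝓝 e) := by
    push_cast; exact hulim
  have hH : Tendsto (fun k => Real.binEntropy (((2 * u k : ℕ) : ℝ) / n k)) atTop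
      (𝓝 (Real.binEntropy e)) := (Real.binEntropy_continuous.tendsto e).comp hulim'
  set E := exponent l₁ l₂ Γ₁ Γ₂ e v₁ v₂ with hE
  -- One third of the slack for the binomial factors and one third for each of the two even counts.
  set η := (E - b) / 3 with hη
  have hη0 : 0 < η := by rw [hη]; linarith
  have hlog := tendsto_log_mul_add_one_div hn le_rfl
  have h3 := ((hH.const_mul (1 - l₁ - l₂ : ℝ)).sub hlog).eventually_const_lt
    (show (1 - l₁ - l₂ : ℝ) * Real.binEntropy e - η < (1 - l₁ - l₂ : ℝ) * Real.binEntropy e - 0 by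
      linarith)
  filter_upwards [h3, hn.eventually_gt_atTop 0,
    hM₁.eventually_le_log_evenCount hΓ₁ hl₁ hn hv₁ (hs₁.symm ▸ hulim) hη0,
    hM₂.eventually_le_log_evenCount hΓ₂ hl₂ hn hv₂ (hs₂.symm ▸ hulim) hη0] with k h3 hk h4 h5
  have hk' : (0 : ℝ) < n k := by exact_mod_cast hk
  rw [← mul_assoc] at h4 h5
  refine ⟨2 * u k, hle k, ?_⟩
  obtain ⟨hpos, hlog⟩ := log_weightTerm (hle k) h4.1 h5.1
  rw [← Real.le_log_iff_exp_le hpos, hlog]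
  have b1 := (log_choose_mul_bounds (hle k) hl₁).2
  have b2 := (log_choose_mul_bounds (hle k) hl₂).2
  have b0 := (log_choose_bounds (hle k)).1
  have a1 := h4.2
  have a2 := h5.2
  rw [hs₁, le_div_iff₀ hk'] at a1
  rw [hs₂, le_div_iff₀ hk'] at a2
  have h6 := mul_lt_mul_of_pos_right h3 hk'
  rw [sub_mul _ (Real.log _ / _), div_mul_cancel₀ _ hk'.ne', mul_one] at h6
  have hEb : b = E - 3 * η := by rw [hη]; ring
  have hbE : n k * b = ((1 - l₁ - l₂ : ℝ) * Real.binEntropy e - η) * n k +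
      (l₁ / avgDegree Γ₁ * meanLogQ Γ₁ v₁ - e * l₁ * Real.log v₁ - η) * n k +
      (l₂ / avgDegree Γ₂ * meanLogQ Γ₂ v₂ - e * l₂ * Real.log v₂ - η) * n k := by
    rw [hEb, hE, exponent]; ring
  rw [hbE]
  linarith

/-- Above `maxFraction` the term -e l log v outweighs the growth of `meanLogQ`, so v → ∞ drives the
expression to -∞. -/
theorem exists_single_exponent_le {l : ℕ} {Γ : ℝ[X]} (hΓ : IsProperDegreeDist Γ) (hl : 1 ≤ l)
    {e : ℝ} (he : maxFraction Γ < e) (b : ℝ) :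
    ∃ v, 0 < v ∧ l / avgDegree Γ * meanLogQ Γ v - e * l * Real.log v ≤ b := by
  have hA := hΓ.avgDegree_pos
  have hlR : (0 : ℝ) < l := by exact_mod_cast hl
  have hlim : Tendsto (fun v : ℝ => l * Real.log 2 - l * (e - maxFraction Γ) * Real.log v) atTop
      atBot := by
    have := Real.tendsto_log_atTop.const_mul_atTop (mul_pos hlR (sub_pos.2 he))
    simpa [sub_eq_add_neg] using
      tendsto_atBot_add_const_left atTop (l * Real.log 2) (tendsto_neg_atTop_atBot.comp this)
  obtain ⟨v, hv1, hvb⟩ := ((eventually_ge_atTop 1).and (hlim.eventually_le_atBot b)).exists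
  refine ⟨v, by linarith, le_trans ?_ hvb⟩
  have h1 := mul_le_mul_of_nonneg_left (hΓ.meanLogQ_le hv1) (div_nonneg hlR.le hA.le)
  have h2 : l / avgDegree Γ * (avgDegree Γ * Real.log 2 +
      avgDegree Γ * maxFraction Γ * Real.log v) = l * Real.log 2 +
      l * maxFraction Γ * Real.log v := by field_simp
  linarith

/-- Close to a limit point of the domain, on the correct side, the saddle point parameters bound the
exponent at the limit point. -/
theorem exists_exponent_le_of_filter {S e e₀ : ℝ} (F : Filter ℝ) [F.NeBot] (hF : F ≤ 𝓝 e)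
    (hS : ∀ e' ∈ thetaDomain Γ₁ Γ₂,
      exponent l₁ l₂ Γ₁ Γ₂ e' (saddleRoot Γ₁ e') (saddleRoot Γ₂ e') ≤ S)
    (hFD : ∀ᶠ e' in F, e' ∈ thetaDomain Γ₁ Γ₂ ∧ 0 < saddleRoot Γ₁ e' ∧ 0 < saddleRoot Γ₂ e' ∧
      (e' - e) * (Real.log (saddleRoot Γ₁ e') - Real.log (saddleRoot Γ₁ e₀)) ≤ 0 ∧
      (e' - e) * (Real.log (saddleRoot Γ₂ e') - Real.log (saddleRoot Γ₂ e₀)) ≤ 0) {η : ℝ}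
    (hη : 0 < η) :
    ∃ v₁ v₂, 0 < v₁ ∧ 0 < v₂ ∧ exponent l₁ l₂ Γ₁ Γ₂ e v₁ v₂ ≤ S + η := by
  -- Evaluating the exponent at e instead of e', with the parameters of e', changes it by at most g
  -- e'. The sign hypotheses replace log v(e'), possibly unbounded near e, by the fixed log v(e₀).
  set g : ℝ → ℝ := fun e' => (1 - l₁ - l₂) * (Real.binEntropy e - Real.binEntropy e') +
    (e' - e) * (l₁ * Real.log (saddleRoot Γ₁ e₀) + l₂ * Real.log (saddleRoot Γ₂ e₀)) with hg
  have hgc : Continuous g := by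
    have := Real.binEntropy_continuous
    fun_prop
  have hg0 : g e = 0 := by simp [hg]
  have hglim : Tendsto g F (𝓝 0) := hg0 ▸ (hgc.tendsto e).mono_left hF
  obtain ⟨e', ⟨hD, hp₁, hp₂, h1, h2⟩, h3⟩ := (hFD.and (hglim.eventually_lt_const hη)).exists
  refine ⟨_, _, hp₁, hp₂, ?_⟩
  have h4 := hS e' hD
  have h1' := mul_le_mul_of_nonneg_left h1 (Nat.cast_nonneg (α := ℝ) l₁)
  have h2' := mul_le_mul_of_nonneg_left h2 (Nat.cast_nonneg (α := ℝ) l₂)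
  simp only [hg] at h3
  rw [exponent] at h4 ⊢
  linarith

/-- Three regimes: beyond one of the two `maxFraction` values the exponent can be made arbitrarily
small; inside the domain the saddle parameters serve; at either end one approaches from inside,
where monotonicity of `saddleRoot` supplies the sign conditions. -/
theorem exists_exponent_le (hΓ₁ : IsProperDegreeDist Γ₁) (hΓ₂ : IsProperDegreeDist Γ₂)
    (hl₁ : 1 ≤ l₁) (hl₂ : 1 ≤ l₂) {S : ℝ}
    (hS : ∀ e ∈ thetaDomain Γ₁ Γ₂,
      exponent l₁ l₂ Γ₁ Γ₂ e (saddleRoot Γ₁ e) (saddleRoot Γ₂ e) ≤ S)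
    {e : ℝ} (he : 0 ≤ e) {η : ℝ} (hη : 0 < η) :
    ∃ v₁ v₂, 0 < v₁ ∧ 0 < v₂ ∧ exponent l₁ l₂ Γ₁ Γ₂ e v₁ v₂ ≤ S + η := by
  obtain h | h₁ := lt_or_ge (maxFraction Γ₁) e
  · obtain ⟨v, hv, hvb⟩ := exists_single_exponent_le hΓ₁ hl₁ h (S - (1 - l₁ - l₂) *
      Real.binEntropy e - (l₂ / avgDegree Γ₂ * meanLogQ Γ₂ 1 - e * l₂ * Real.log 1))
    exact ⟨v, 1, hv, one_pos, by rw [exponent]; linarith⟩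
  obtain h | h₂ := lt_or_ge (maxFraction Γ₂) e
  · obtain ⟨v, hv, hvb⟩ := exists_single_exponent_le hΓ₂ hl₂ h (S - (1 - l₁ - l₂) *
      Real.binEntropy e - (l₁ / avgDegree Γ₁ * meanLogQ Γ₁ 1 - e * l₁ * Real.log 1))
    exact ⟨1, v, one_pos, hv, by rw [exponent]; linarith⟩
  have hD := thetaDomain_eq hΓ₁ hΓ₂
  set ε := min (maxFraction Γ₁) (maxFraction Γ₂) with hε
  have hε0 : 0 < ε := lt_min hΓ₁.maxFraction_pos hΓ₂.maxFraction_pos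
  have heε : e ≤ ε := le_min h₁ h₂
  have hD₁ : ∀ {x}, x ∈ Ioo 0 ε → x ∈ Ioo 0 (maxFraction Γ₁) :=
    fun hx => ⟨hx.1, hx.2.trans_le (min_le_left _ _)⟩
  have hD₂ : ∀ {x}, x ∈ Ioo 0 ε → x ∈ Ioo 0 (maxFraction Γ₂) :=
    fun hx => ⟨hx.1, hx.2.trans_le (min_le_right _ _)⟩
  have hpos₁ : ∀ {x}, x ∈ Ioo 0 ε → 0 < saddleRoot Γ₁ x :=
    fun hx => (hΓ₁.saddleRoot_spec (hD₁ hx)).1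
  have hpos₂ : ∀ {x}, x ∈ Ioo 0 ε → 0 < saddleRoot Γ₂ x :=
    fun hx => (hΓ₂.saddleRoot_spec (hD₂ hx)).1
  have hmono₁ : ∀ {x y}, x ∈ Ioo 0 ε → y ∈ Ioo 0 ε → x ≤ y →
      Real.log (saddleRoot Γ₁ x) ≤ Real.log (saddleRoot Γ₁ y) := fun hx hy hxy =>
    Real.log_le_log (hpos₁ hx) (hΓ₁.saddleRoot_monotoneOn (hD₁ hx) (hD₁ hy) hxy)
  have hmono₂ : ∀ {x y}, x ∈ Ioo 0 ε → y ∈ Ioo 0 ε → x ≤ y →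
      Real.log (saddleRoot Γ₂ x) ≤ Real.log (saddleRoot Γ₂ y) := fun hx hy hxy =>
    Real.log_le_log (hpos₂ hx) (hΓ₂.saddleRoot_monotoneOn (hD₂ hx) (hD₂ hy) hxy)
  have he₀ : ε / 2 ∈ Ioo 0 ε := ⟨half_pos hε0, half_lt_self hε0⟩
  obtain rfl | he0 := he.eq_or_lt
  · refine exists_exponent_le_of_filter (e₀ := ε / 2) (𝓝[>] 0) nhdsWithin_le_nhds hS ?_ hη
    filter_upwards [Ioo_mem_nhdsGT he₀.1] with x hx
    have hx' : x ∈ Ioo 0 ε := ⟨hx.1, hx.2.trans he₀.2⟩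
    rw [hD, sub_zero]
    exact ⟨hx', hpos₁ hx', hpos₂ hx',
      mul_nonpos_of_nonneg_of_nonpos hx.1.le (sub_nonpos.2 (hmono₁ hx' he₀ hx.2.le)),
      mul_nonpos_of_nonneg_of_nonpos hx.1.le (sub_nonpos.2 (hmono₂ hx' he₀ hx.2.le))⟩
  obtain rfl | heε' := heε.eq_or_lt
  · refine exists_exponent_le_of_filter (e₀ := ε / 2) (𝓝[<] ε) nhdsWithin_le_nhds hS ?_ hη
    filter_upwards [Ioo_mem_nhdsLT he₀.2] with x hx
    have hx' : x ∈ Ioo 0 ε := ⟨he₀.1.trans hx.1, hx.2⟩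
    rw [hD]
    exact ⟨hx', hpos₁ hx', hpos₂ hx',
      mul_nonpos_of_nonpos_of_nonneg (sub_nonpos.2 hx.2.le)
        (sub_nonneg.2 (hmono₁ he₀ hx' hx.1.le)),
      mul_nonpos_of_nonpos_of_nonneg (sub_nonpos.2 hx.2.le)
        (sub_nonneg.2 (hmono₂ he₀ hx' hx.1.le))⟩
  · have he' : e ∈ Ioo 0 ε := ⟨he0, heε'⟩
    exact ⟨_, _, hpos₁ he', hpos₂ he', by linarith [hS e (hD ▸ he')]⟩

/-- Uniformity by compactness: weights violating the bound along a subsequence would have a limiting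
relative weight e, and the bound for sequences tending to e contradicts this. -/
theorem eventually_forall_weightTerm_le (hΓ₁ : IsProperDegreeDist Γ₁)
    (hΓ₂ : IsProperDegreeDist Γ₂) (hl₁ : 1 ≤ l₁) (hl₂ : 1 ≤ l₂) (hn : Tendsto n atTop atTop)
    (hM₁ : FollowsDegreeDist l₁ Γ₁ n M₁) (hM₂ : FollowsDegreeDist l₂ Γ₂ n M₂) {S b : ℝ}
    (hS : ∀ e ∈ thetaDomain Γ₁ Γ₂,
      exponent l₁ l₂ Γ₁ Γ₂ e (saddleRoot Γ₁ e) (saddleRoot Γ₂ e) ≤ S) (hb : S < b) :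
    ∀ᶠ k in atTop, ∀ w ≤ n k,
      weightTerm (n k) l₁ l₂ (M₁ k) (M₂ k) w ≤ Real.exp (n k * b) := by
  by_contra hcon
  obtain ⟨φ, hφ, hφP⟩ := extraction_of_frequently_atTop (not_eventually.1 hcon)
  push Not at hφP
  choose w hw hwt using hφP
  have hmem : ∀ k, (w k : ℝ) / n (φ k) ∈ Icc (0 : ℝ) 1 := fun k =>
    ⟨by positivity, div_le_one_of_le₀ (by exact_mod_cast hw k) (Nat.cast_nonneg _)⟩
  obtain ⟨e, he, ψ, hψ, hlim⟩ := isCompact_Icc.tendsto_subseq hmem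
  obtain ⟨v₁, v₂, hv₁, hv₂, hv⟩ := exists_exponent_le hΓ₁ hΓ₂ hl₁ hl₂ hS he.1
    (show 0 < (b - S) / 2 by linarith)
  have hφψ : Tendsto (φ ∘ ψ) atTop atTop := hφ.tendsto_atTop.comp hψ.tendsto_atTop
  obtain ⟨k, hk⟩ := (eventually_weightTerm_le hl₁ hl₂ (hn.comp hφψ) (hM₁.comp hφψ) (hM₂.comp hφψ)
    (w := w ∘ ψ) (fun k => hw (ψ k)) hlim hv₁ hv₂
    (show exponent l₁ l₂ Γ₁ Γ₂ e v₁ v₂ < b by linarith)).exists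
  exact (hwt (ψ k)).not_ge hk

/-- One term with exponent close to S bounds the sum from below; from above it is at most n + 1
times a uniform bound. -/
theorem tendsto_log_expNumCodewords (hΓ₁ : IsProperDegreeDist Γ₁) (hΓ₂ : IsProperDegreeDist Γ₂)
    (hl₁ : 1 ≤ l₁) (hl₂ : 1 ≤ l₂) (hn : Tendsto n atTop atTop)
    (hM₁ : FollowsDegreeDist l₁ Γ₁ n M₁) (hM₂ : FollowsDegreeDist l₂ Γ₂ n M₂) {S : ℝ}
    (hS : IsLUB ((fun e => exponent l₁ l₂ Γ₁ Γ₂ e (saddleRoot Γ₁ e) (saddleRoot Γ₂ e)) ''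
      thetaDomain Γ₁ Γ₂) S) :
    (∀ᶠ k in atTop, 0 < expNumCodewords (n k) l₁ l₂ (M₁ k) (M₂ k)) ∧
    Tendsto (fun k => Real.log (expNumCodewords (n k) l₁ l₂ (M₁ k) (M₂ k)) / n k) atTop (𝓝 S) := by
  have hlow : ∀ a < S, ∀ᶠ k in atTop,
      Real.exp (n k * a) ≤ expNumCodewords (n k) l₁ l₂ (M₁ k) (M₂ k) := by
    intro a ha
    obtain ⟨_, ⟨e, he, rfl⟩, hae, -⟩ := hS.exists_between ha
    filter_upwards [eventually_le_weightTerm hΓ₁ hΓ₂ hl₁ hl₂ hn hM₁ hM₂ he hae] with k hk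
    obtain ⟨w, hw, hle⟩ := hk
    rw [expNumCodewords_eq (hM₁.edges k) (hM₂.edges k)]
    exact hle.trans (Finset.single_le_sum
      (f := weightTerm (n k) l₁ l₂ (M₁ k) (M₂ k)) (fun w _ => weightTerm_nonneg _ _ _ _ _ w)
      (Finset.mem_range.2 (Nat.lt_succ_of_le hw)))
  have hpos : ∀ᶠ k in atTop, 0 < expNumCodewords (n k) l₁ l₂ (M₁ k) (M₂ k) :=
    (hlow (S - 1) (sub_one_lt S)).mono fun k hk => (Real.exp_pos _).trans_le hk
  refine ⟨hpos, tendsto_order.2 ⟨fun a ha => ?_, fun b hb => ?_⟩⟩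
  · obtain ⟨a', haa', ha'⟩ := exists_between ha
    filter_upwards [hlow a' ha', hpos, hn.eventually_gt_atTop 0] with k h1 h2 hk
    have hk' : (0 : ℝ) < n k := by exact_mod_cast hk
    refine haa'.trans_le ?_
    rw [le_div_iff₀ hk', mul_comm]
    exact (Real.le_log_iff_exp_le h2).2 h1
  · obtain ⟨b', hb', hbb'⟩ := exists_between hb
    filter_upwards [eventually_forall_weightTerm_le hΓ₁ hΓ₂ hl₁ hl₂ hn hM₁ hM₂
      (fun e he => hS.1 ⟨e, he, rfl⟩) hb', hpos, hn.eventually_gt_atTop 0,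
      (tendsto_log_mul_add_one_div hn le_rfl).eventually_lt_const (sub_pos.2 hbb')]
      with k h1 h2 hk h3
    have hk' : (0 : ℝ) < n k := by exact_mod_cast hk
    have h4 : expNumCodewords (n k) l₁ l₂ (M₁ k) (M₂ k) ≤
        ((n k * 1 : ℕ) + 1) * Real.exp (n k * b') := by
      rw [expNumCodewords_eq (hM₁.edges k) (hM₂.edges k)]
      refine (Finset.sum_le_card_nsmul _ _ _ fun w hw =>
        h1 w (Nat.lt_succ_iff.1 (Finset.mem_range.1 hw))).trans_eq ?_
      simp
    have h5 := Real.log_le_log h2 h4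
    rw [Real.log_mul (by positivity) (Real.exp_ne_zero _), Real.log_exp] at h5
    rw [div_lt_iff₀ hk'] at h3 ⊢
    linarith

end

/-! ### Concentration of the rate -/

theorem numCodewords_pos {n l₁ l₂ : ℕ} {M₁ M₂ : ℕ →₀ ℕ} (G : TannerGraph n l₁ l₂ M₁ M₂) :
    0 < numCodewords G := by
  rw [numCodewords, Set.ncard_pos]
  exact ⟨0, by simp [codewords]⟩

/-- Markov's inequality for N, since R_G > t means N > 2^{nt}. -/
theorem probRateGT_le {n l₁ l₂ : ℕ} (hn : 0 < n) (M₁ M₂ : ℕ →₀ ℕ) (t : ℝ) :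
    probRateGT n l₁ l₂ M₁ M₂ t ≤
      expNumCodewords n l₁ l₂ M₁ M₂ * Real.exp (-(n * (t * Real.log 2))) := by
  classical
  have hnR : (0 : ℝ) < n := by exact_mod_cast hn
  have hlog : 0 < Real.log 2 := Real.log_pos one_lt_two
  rw [probRateGT, expNumCodewords, div_mul_eq_mul_div]
  refine div_le_div_of_nonneg_right ?_ (Nat.cast_nonneg _)
  rw [← Finset.coe_filter_univ, Set.ncard_coe_finset, Finset.card_filter, Finset.sum_mul,
    Nat.cast_sum]
  refine Finset.sum_le_sum fun G _ => ?_
  split_ifs with h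
  · have hN : (0 : ℝ) < numCodewords G := by exact_mod_cast numCodewords_pos G
    rw [rate, Real.logb, div_div, lt_div_iff₀ (by positivity)] at h
    have h1 : Real.exp (n * (t * Real.log 2)) ≤ numCodewords G := by
      rw [← Real.le_log_iff_exp_le hN]
      linarith
    rw [Real.exp_neg, Nat.cast_one, ← div_eq_mul_inv, le_div_iff₀ (Real.exp_pos _), one_mul]
    exact h1
  · rw [Nat.cast_zero]; positivity

theorem probRateGT_nonneg (n l₁ l₂ : ℕ) (M₁ M₂ : ℕ →₀ ℕ) (t : ℝ) :
    0 ≤ probRateGT n l₁ l₂ M₁ M₂ t := by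
  rw [probRateGT]; positivity

theorem tendsto_probRateGT {l₁ l₂ : ℕ} {n : ℕ → ℕ} {M₁ M₂ : ℕ → ℕ →₀ ℕ}
    (hn : Tendsto n atTop atTop)
    (hpos : ∀ᶠ k in atTop, 0 < expNumCodewords (n k) l₁ l₂ (M₁ k) (M₂ k)) {S t : ℝ}
    (hlim : Tendsto (fun k => Real.log (expNumCodewords (n k) l₁ l₂ (M₁ k) (M₂ k)) / n k) atTop
      (𝓝 S)) (ht : S < t * Real.log 2) :
    Tendsto (fun k => probRateGT (n k) l₁ l₂ (M₁ k) (M₂ k) t) atTop (𝓝 0) := by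
  have hnR : Tendsto (fun k => (n k : ℝ)) atTop atTop := tendsto_natCast_atTop_atTop.comp hn
  obtain ⟨b, hSb, hbt⟩ := exists_between ht
  have hexp : Tendsto (fun k => Real.exp (-(n k * (t * Real.log 2 - b)))) atTop (𝓝 0) :=
    Real.tendsto_exp_neg_atTop_nhds_zero.comp (hnR.atTop_mul_const (sub_pos.2 hbt))
  refine squeeze_zero' (Eventually.of_forall fun k => probRateGT_nonneg _ _ _ _ _ _) ?_ hexp
  filter_upwards [hpos, hlim.eventually_lt_const hSb, hn.eventually_gt_atTop 0] with k h1 h2 hk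
  have hk' : (0 : ℝ) < n k := by exact_mod_cast hk
  refine (probRateGT_le hk _ _ t).trans ?_
  rw [div_lt_iff₀ hk', mul_comm, Real.log_lt_iff_lt_exp h1] at h2
  refine (mul_le_mul_of_nonneg_right h2.le (Real.exp_nonneg _)).trans_eq ?_
  rw [← Real.exp_add]
  ring_nf

/-! ### The supremum of `θ` -/

/-- By `meanLogQ_sub_le` each type contributes at most its value at v = 1, and the entropy term is
nonpositive because l₁ ≥ 1. -/
theorem bddAbove_theta {l₁ l₂ : ℕ} {Γ₁ Γ₂ : ℝ[X]} (hΓ₁ : IsProperDegreeDist Γ₁)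
    (hΓ₂ : IsProperDegreeDist Γ₂) (hl₁ : 1 ≤ l₁) :
    BddAbove (theta l₁ l₂ Γ₁ Γ₂ '' thetaDomain Γ₁ Γ₂) := by
  refine ⟨(l₁ / avgDegree Γ₁ * meanLogQ Γ₁ 1 + l₂ / avgDegree Γ₂ * meanLogQ Γ₂ 1) / Real.log 2 -
    designRate l₁ l₂ Γ₁ Γ₂, ?_⟩
  rintro _ ⟨e, he, rfl⟩
  have hsingle : ∀ {l : ℕ} {Γ : ℝ[X]}, IsProperDegreeDist Γ →
      (∃ v, 0 < v ∧ saddle Γ v = e) → l / avgDegree Γ * meanLogQ Γ (saddleRoot Γ e) -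
        e * l * Real.log (saddleRoot Γ e) ≤ l / avgDegree Γ * meanLogQ Γ 1 := by
    intro l Γ hΓ hex
    obtain ⟨hv, hs⟩ := hΓ.saddleRoot_spec (hΓ.exists_saddle_eq_iff.1 hex)
    have hA := hΓ.avgDegree_pos
    have h := mul_le_mul_of_nonneg_left (hΓ.meanLogQ_sub_le hv)
      (show 0 ≤ l / avgDegree Γ by positivity)
    rw [hs] at h
    refine le_trans (le_of_eq ?_) h
    field_simp
  rw [theta_eq, sub_le_sub_iff_right]
  refine div_le_div_of_nonneg_right ?_ (Real.log_pos one_lt_two).le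
  rw [exponent]
  have h1 := hsingle (l := l₁) hΓ₁ he.2.1
  have h2 := hsingle (l := l₂) hΓ₂ he.2.2
  have hH : 0 ≤ Real.binEntropy e := Real.binEntropy_nonneg he.1.1.le he.1.2.le
  have hl : (1 - l₁ - l₂ : ℝ) ≤ 0 := by
    have : (1 : ℝ) ≤ l₁ := by exact_mod_cast hl₁
    linarith [(Nat.cast_nonneg l₂ : (0 : ℝ) ≤ l₂)]
  linarith [mul_nonpos_of_nonpos_of_nonneg hl hH]

theorem isLUB_exponent {l₁ l₂ : ℕ} {Γ₁ Γ₂ : ℝ[X]} {s : ℝ}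
    (hs : IsLUB (theta l₁ l₂ Γ₁ Γ₂ '' thetaDomain Γ₁ Γ₂) s) :
    IsLUB ((fun e => exponent l₁ l₂ Γ₁ Γ₂ e (saddleRoot Γ₁ e) (saddleRoot Γ₂ e)) ''
      thetaDomain Γ₁ Γ₂) ((s + designRate l₁ l₂ Γ₁ Γ₂) * Real.log 2) := by
  have hlog : 0 < Real.log 2 := Real.log_pos one_lt_two
  constructor
  · rintro _ ⟨e, he, rfl⟩
    have := hs.1 ⟨e, he, rfl⟩
    rwa [theta_eq, sub_le_iff_le_add, div_le_iff₀ hlog] at this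
  · intro b hb
    rw [← le_div_iff₀ hlog, ← le_sub_iff_add_le]
    refine hs.2 ?_
    rintro _ ⟨e, he, rfl⟩
    rw [theta_eq]
    exact sub_le_sub_right (div_le_div_of_nonneg_right (hb ⟨e, he, rfl⟩) hlog.le) _

/-- At v = 1 all even subsets are equally likely, and for r ≥ 2 each socket then belongs to one with
probability 1/2. A node of degree 1 has only the empty even subset. -/
theorem saddle_one {Γ : ℝ[X]} (hΓ : IsProperDegreeDist Γ) (h : ∀ r < 2, Γ.coeff r = 0) :
    saddle Γ 1 = 1 / 2 := by
  rw [saddle_eq_sum, div_eq_iff hΓ.avgDegree_pos.ne', avgDegree_eq_sum, Polynomial.sum,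
    Polynomial.sum, Finset.mul_sum]
  refine Finset.sum_congr rfl fun r hr => ?_
  have hr2 : 2 ≤ r := by
    by_contra hlt
    exact Polynomial.mem_support_iff.1 hr (h r (by omega))
  obtain ⟨m, rfl⟩ := Nat.exists_eq_add_of_le' hr2
  have h2 : (2 : ℝ) ^ (m + 1) ≠ 0 := by positivity
  rw [meanSize, show m + 2 - 1 = m + 1 by omega, sub_self, zero_pow (by omega),
    zero_pow (by omega), one_add_one_eq_two, pow_succ 2 (m + 1)]
  field_simp
  ring

/-- An r-element set with r ≥ 1 has 2^{r-1} even subsets; the formula fails for r = 0. -/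
theorem meanLogQ_one {Γ : ℝ[X]} (hΓ : IsProperDegreeDist Γ) (h : ∀ r < 2, Γ.coeff r = 0) :
    meanLogQ Γ 1 = (avgDegree Γ - 1) * Real.log 2 := by
  have h1 : (∑ r ∈ Γ.support, Γ.coeff r) = 1 := by
    simpa [Polynomial.eval_eq_sum, Polynomial.sum] using hΓ.sum_eq_one
  have h2 : (avgDegree Γ - 1) * Real.log 2 =
      ∑ r ∈ Γ.support, (Γ.coeff r * r - Γ.coeff r) * Real.log 2 := by
    rw [← Finset.sum_mul, Finset.sum_sub_distrib, h1, avgDegree_eq_sum, Polynomial.sum]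
  rw [h2, meanLogQ, Polynomial.sum]
  refine Finset.sum_congr rfl fun r hr => ?_
  have hr2 : 2 ≤ r := by
    by_contra hlt
    exact Polynomial.mem_support_iff.1 hr (h r (by omega))
  obtain ⟨m, rfl⟩ := Nat.exists_eq_add_of_le' hr2
  have : q (m + 2) 1 = 2 ^ (m + 1) := by
    rw [q, sub_self, zero_pow (by omega), one_add_one_eq_two]
    ring
  rw [this, Real.log_pow]
  push_cast
  ring

/-- Both saddle roots are 1, and in bits the exponent becomes 1 - l₁ - l₂ + Σ_j l_j (1 - 1/Γ_j'(1)),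
the design rate. -/
theorem theta_half {l₁ l₂ : ℕ} {Γ₁ Γ₂ : ℝ[X]} (hΓ₁ : IsProperDegreeDist Γ₁)
    (hΓ₂ : IsProperDegreeDist Γ₂) (h₁ : ∀ r < 2, Γ₁.coeff r = 0) (h₂ : ∀ r < 2, Γ₂.coeff r = 0) :
    theta l₁ l₂ Γ₁ Γ₂ (1 / 2) = 0 := by
  have hlog : Real.log 2 ≠ 0 := (Real.log_pos one_lt_two).ne'
  have hA₁ := hΓ₁.avgDegree_pos.ne'
  have hA₂ := hΓ₂.avgDegree_pos.ne'
  have e₁ : saddleRoot Γ₁ (1 / 2) = 1 := by rw [← saddle_one hΓ₁ h₁, hΓ₁.saddleRoot_eq one_pos]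
  have e₂ : saddleRoot Γ₂ (1 / 2) = 1 := by rw [← saddle_one hΓ₂ h₂, hΓ₂.saddleRoot_eq one_pos]
  have eH : Real.binEntropy (1 / 2) = Real.log 2 := by
    rw [one_div, Real.binEntropy_two_inv]
  rw [theta_eq, e₁, e₂, exponent, meanLogQ_one hΓ₁ h₁, meanLogQ_one hΓ₂ h₂, eH, Real.log_one,
    designRate]
  field_simp
  ring

end TwoEdgeLDPC

/-! ### The main statement -/

open TwoEdgeLDPC
theorem mainTheorem8 (l₁ l₂ : ℕ) (hl₁ : 1 ≤ l₁) (hl₂ : 1 ≤ l₂) (Γ₁ Γ₂ : ℝ[X])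
    (hΓ₁ : IsDegreeDist Γ₁) (hΓ₂ : IsDegreeDist Γ₂)
    (hdeg₁ : ∃ r, 2 ≤ r ∧ Γ₁.coeff r ≠ 0) (hdeg₂ : ∃ r, 2 ≤ r ∧ Γ₂.coeff r ≠ 0) :
    -- existence, uniqueness and range of the saddle point solutions `v₁`, `v₂`
    (∀ e ∈ Ioo 0 (maxFraction Γ₁), ∃! v : ℝ, 0 < v ∧ saddle Γ₁ v = e) ∧
    (∀ e ∈ Ioo 0 (maxFraction Γ₂), ∃! v : ℝ, 0 < v ∧ saddle Γ₂ v = e) ∧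
    thetaDomain Γ₁ Γ₂ = Ioo 0 (min (maxFraction Γ₁) (maxFraction Γ₂)) ∧
    -- the supremum of `θ` is taken over a nonempty bounded set of reals
    (theta l₁ l₂ Γ₁ Γ₂ '' thetaDomain Γ₁ Γ₂).Nonempty ∧
    BddAbove (theta l₁ l₂ Γ₁ Γ₂ '' thetaDomain Γ₁ Γ₂) ∧
    -- growth rate of `𝔼[N]`, and concentration of the rate
    (∀ (n : ℕ → ℕ) (M₁ M₂ : ℕ → ℕ →₀ ℕ), Tendsto n atTop atTop →
      FollowsDegreeDist l₁ Γ₁ n M₁ → FollowsDegreeDist l₂ Γ₂ n M₂ →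
      Tendsto (fun k => Real.logb 2 (expNumCodewords (n k) l₁ l₂ (M₁ k) (M₂ k)) / n k) atTop
        (𝓝 (sSup (theta l₁ l₂ Γ₁ Γ₂ '' thetaDomain Γ₁ Γ₂) + designRate l₁ l₂ Γ₁ Γ₂)) ∧
      (sSup (theta l₁ l₂ Γ₁ Γ₂ '' thetaDomain Γ₁ Γ₂) = 0 → ∀ δ : ℝ, 0 < δ →
        Tendsto (fun k => probRateGT (n k) l₁ l₂ (M₁ k) (M₂ k) (designRate l₁ l₂ Γ₁ Γ₂ + δ)) atTop
          (𝓝 0))) ∧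
    -- reformulation of the condition `sup θ = 0`
    ((∀ r < 2, Γ₁.coeff r = 0 ∧ Γ₂.coeff r = 0) →
      (1 / 2 : ℝ) ∈ thetaDomain Γ₁ Γ₂ ∧
      (sSup (theta l₁ l₂ Γ₁ Γ₂ '' thetaDomain Γ₁ Γ₂) = 0 ↔
        ∀ e ∈ thetaDomain Γ₁ Γ₂, theta l₁ l₂ Γ₁ Γ₂ e ≤ theta l₁ l₂ Γ₁ Γ₂ (1 / 2))) := by 
  have h₁ : IsProperDegreeDist Γ₁ := ⟨hΓ₁, hdeg₁⟩
  have h₂ : IsProperDegreeDist Γ₂ := ⟨hΓ₂, hdeg₂⟩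
  have hlog : 0 < Real.log 2 := Real.log_pos one_lt_two
  have hD := thetaDomain_eq h₁ h₂
  have hne : (theta l₁ l₂ Γ₁ Γ₂ '' thetaDomain Γ₁ Γ₂).Nonempty := by
    rw [Set.image_nonempty, hD, nonempty_Ioo]
    exact lt_min h₁.maxFraction_pos h₂.maxFraction_pos
  have hbdd := bddAbove_theta h₁ h₂ hl₁ (l₂ := l₂)
  have hlub := isLUB_csSup hne hbdd
  refine ⟨fun e he => h₁.existsUnique_saddle_eq he, fun e he => h₂.existsUnique_saddle_eq he, hD,
    hne, hbdd, fun n M₁ M₂ hn hM₁ hM₂ => ?_, fun hΓ => ?_⟩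
  · obtain ⟨hpos, hlim⟩ :=
      tendsto_log_expNumCodewords h₁ h₂ hl₁ hl₂ hn hM₁ hM₂ (isLUB_exponent hlub)
    refine ⟨?_, fun hsup δ hδ => ?_⟩
    · have := hlim.div_const (Real.log 2)
      rw [mul_div_cancel_right₀ _ hlog.ne'] at this
      refine this.congr fun k => ?_
      rw [Real.logb, div_right_comm]
    · refine tendsto_probRateGT hn hpos hlim ?_
      rw [hsup, zero_add]
      exact mul_lt_mul_of_pos_right (lt_add_of_pos_right _ hδ) hlog
  · have hc₁ : ∀ r < 2, Γ₁.coeff r = 0 := fun r hr => (hΓ r hr).1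
    have hc₂ : ∀ r < 2, Γ₂.coeff r = 0 := fun r hr => (hΓ r hr).2
    have hhalf : (1 / 2 : ℝ) ∈ thetaDomain Γ₁ Γ₂ :=
      ⟨by norm_num, ⟨1, one_pos, saddle_one h₁ hc₁⟩, 1, one_pos, saddle_one h₂ hc₂⟩
    -- The value 0 is always attained at 1/2, so the supremum is nonnegative and vanishes exactly
    -- when no value of θ exceeds θ(1/2).
    have hθ := theta_half h₁ h₂ hc₁ hc₂ (l₁ := l₁) (l₂ := l₂)
    refine ⟨hhalf, fun hsup e he => ?_, fun hmax => ?_⟩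
    · rw [hθ, ← hsup]
      exact hlub.1 ⟨e, he, rfl⟩
    · refine (IsGreatest.csSup_eq ⟨⟨_, hhalf, hθ⟩, ?_⟩)
      rintro _ ⟨e, he, rfl⟩
      exact hθ ▸ hmax e he
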